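/- Let $W=(W(f))_{f\in L_2(0,1)}$ be Gaussian white noise on $(0,1)$, that is, a centred Gaussian process with $\mathbf E[W(f)W(g)]=\int_0^1 fg\,dt$; we write $W(f)=\int_0^1 f\,dw$. For $\varepsilon>0$ and $S\in L_2(0,1)$ one observes $dY_\varepsilon(t)=S(t)\,dt+\varepsilon\,dw(t)$, $t\in[0,1]$. Let $(\phi_j)_{j\ge1}$ be an orthonormal system in $L_2(0,1)$, and put $\theta_j=\int_0^1 S\phi_j\,dt$ and $y_{\varepsilon j}=\int_0^1\phi_j\,dY_\varepsilon=\theta_j+\varepsilon W(\phi_j)$. For each $\varepsilon>0$ let $\varkappa_{\varepsilon j}$, $j\ge 1$, be real numbers with $\rho_\varepsilon^2=\sum_{j\ge1}\varkappa_{\varepsilon j}^2<\infty$. Put $A_\varepsilon=\varepsilon^{-4}\sum_{j\ge1}\varkappa_{\varepsilon j}^4$, $k_\varepsilon=\sup\{k\ge1:\sum_{1\le j<k}\varkappa_{\varepsilon j}^2\le\frac12\rho_\varepsilon^2\}$ and $\varkappa_\varepsilon^2=\varkappa_{\varepsilon k_\varepsilon}^2$. Here $[a]$ is the integer part of $a$,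 and $a_\varepsilon\asymp b_\varepsilon$ means that the ratio $a_\varepsilon/b_\varepsilon$ lies between two positive constants for all sufficiently small $\varepsilon>0$. Assume: * A1. For each $\varepsilon>0$ the sequence $j\mapsto\varkappa_{\varepsilon j}^2$ is non-increasing. * A2. There are constants $C_1,C_2>0$ such that $C_1<A_\varepsilon<C_2$ for all $\varepsilon>0$. * A3. There are $C_1>0$ and $\lambda>1$ such that $\varkappa^2_{\varepsilon,[(1+\delta)k_\varepsilon]}<C_1(1+\delta)^{-\lambda}\varkappa_\varepsilon^2$ for all $\delta>0$ and all $\varepsilon>0$. * A4. $\varkappa_{\varepsilon1}^2\asymp\varkappa_\varepsilon^2$ as $\varepsilon\to0$, and for every $c>1$ there is $C>0$ such that $\varkappa^2_{\varepsilon,[ck_\varepsilon]}\ge C\varkappa_\varepsilon^2$ for all $\varepsilon>0$. Let $0<r<1/2$, $0<2\omega<1-2r$, and suppose that $k_\varepsilon\asymp\varepsilon^{-4+8r+4\omega}$ as $\varepsilon\to0$. Consider the test statistics $T_\varepsilon=\varepsilon^{-2}\sum_{j\ge1}\varkappa_{\varepsilon j}^2y_{\varepsilon j}^2-\rho_\varepsilon^2$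 and the tests $L_\varepsilon=\mathbf 1\{A_\varepsilon^{-1/2}T_\varepsilon>x_\varepsilon\}$ with arbitrary real critical values $x_\varepsilon$, and let $\alpha(L_\varepsilon)=\mathbf E_0L_\varepsilon$ and $\beta(L_\varepsilon,S)=\mathbf E_S(1-L_\varepsilon)$ be their error probabilities under the zero signal and under the signal $S$. A family $S_\varepsilon\in L_2(0,1)$, $\varepsilon>0$, is called $\varepsilon^{-2\omega}$-LD consistent if for every choice of $x_\varepsilon$ with $\varepsilon^{4\omega}\log\alpha(L_\varepsilon)\to0$ as $\varepsilon\to0$ there is $c>0$ such that $|\log\beta(L_\varepsilon,S_\varepsilon)|\ge c\,\varepsilon^{-4\omega}$ for all sufficiently small $\varepsilon>0$ (with $|\log0|=\infty$). Let $S_\varepsilon\in L_2(0,1)$ with $\|S_\varepsilon\|\asymp\varepsilon^{2r}$ as $\varepsilon\to0$, and let $\theta_{\varepsilon j}=\int_0^1S_\varepsilon\phi_j\,dt$. Then the family $S_\varepsilon$ is $\varepsilon^{-2\omega}$-LD consistent if and only if there are $c_1,c_2,\varepsilon_0>0$ such that $$\sum_{j\ge1,\ j<c_2k_\varepsilon}|\theta_{\varepsilon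 j}|^2>c_1\varepsilon^{4r}\qquad\text{for all }0<\varepsilon<\varepsilon_0 .$$ -/

import Mathlib

open MeasureTheory ProbabilityTheory Filter Asymptotics Topology

noncomputable section

namespace SignalDetection

/-- The real Hilbert space `L₂(0,1)`. -/
abbrev L2 : Type := Lp ℝ 2 ((volume : Measure ℝ).restrict (Set.Ioo 0 1))

/-- `W` is a Gaussian white noise on `(0,1)`: a centred Gaussian process indexed by `L₂(0,1)` with
covariance `E[W f · W g] = ∫₀¹ f g`. The variable `W f` is the stochastic integral `∫₀¹ f dw`. -/
structure IsWhiteNoise {Ω : Type*} [MeasurableSpace Ω] (P : Measure Ω) (W : L2 → Ω → ℝ) :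
    Prop where
  isGaussianProcess : IsGaussianProcess W P
  mean_eq_zero : ∀ f, ∫ ω, W f ω ∂P = 0
  covariance_eq : ∀ f g, ∫ ω, W f ω * W g ω ∂P = inner ℝ f g

/-- The Fourier coefficient `θ_j = ∫₀¹ S φ_j dt`. -/
def fourierCoeff (φ : ℕ+ → L2) (S : L2) (j : ℕ+) : ℝ := inner ℝ S (φ j)

/-- The observation `y_{εj} = ∫₀¹ φ_j dY_ε = θ_j + ε ξ_j`, `ξ_j = ∫₀¹ φ_j dw`, in the model
`dY_ε(t) = S(t) dt + ε dw(t)`. -/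
def observation {Ω : Type*} (W : L2 → Ω → ℝ) (φ : ℕ+ → L2) (ε : ℝ) (S : L2) (j : ℕ+) (ω : Ω) : ℝ :=
  fourierCoeff φ S j + ε * W (φ j) ω

/-- `ρ_ε² = ∑_{j ≥ 1} ϰ_{εj}²`. -/
def rhoSq (ϰ : ℝ → ℕ+ → ℝ) (ε : ℝ) : ℝ := ∑' j, ϰ ε j ^ 2

/-- `A_ε = ε⁻⁴ ∑_{j ≥ 1} ϰ_{εj}⁴`. -/
def normA (ϰ : ℝ → ℕ+ → ℝ) (ε : ℝ) : ℝ := (ε ^ 4)⁻¹ * ∑' j, ϰ ε j ^ 4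

/-- `k_ε = sup {k ≥ 1 : ∑_{j < k} ϰ_{εj}² ≤ ρ_ε² / 2}`. -/
def cutoff (ϰ : ℝ → ℕ+ → ℝ) (ε : ℝ) : ℕ :=
  sSup {k : ℕ | 1 ≤ k ∧ ∑ j ∈ Finset.Ico 1 k, ϰ ε j.toPNat' ^ 2 ≤ rhoSq ϰ ε / 2}

/-- `ϰ_ε² = ϰ_{ε, k_ε}²`. -/
def kappaSq (ϰ : ℝ → ℕ+ → ℝ) (ε : ℝ) : ℝ := ϰ ε (cutoff ϰ ε).toPNat' ^ 2

/-- The conditions A1–A4 on the coefficients `ϰ_{εj}²`. The field `summable` is the convergence of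
the series `ρ_ε²` that enters the test statistic. -/
structure Conditions (ϰ : ℝ → ℕ+ → ℝ) : Prop where
  summable : ∀ ε > 0, Summable fun j => ϰ ε j ^ 2
  A1 : ∀ ε > 0, Antitone fun j => ϰ ε j ^ 2
  A2 : ∃ C₁ > 0, ∃ C₂ > 0, ∀ ε > 0, C₁ < normA ϰ ε ∧ normA ϰ ε < C₂
  A3 : ∃ C₁ > 0, ∃ lam > (1 : ℝ), ∀ δ > (0 : ℝ), ∀ ε > 0,
    ϰ ε (⌊(1 + δ) * (cutoff ϰ ε : ℝ)⌋₊).toPNat' ^ 2 < C₁ * (1 + δ) ^ (-lam) * kappaSq ϰ ε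
  A4_first : (fun ε => ϰ ε 1 ^ 2) =Θ[𝓝[>] 0] fun ε => kappaSq ϰ ε
  A4_tail : ∀ c > (1 : ℝ), ∃ C > 0, ∀ ε > 0,
    C * kappaSq ϰ ε ≤ ϰ ε (⌊c * (cutoff ϰ ε : ℝ)⌋₊).toPNat' ^ 2

/-- The test statistic `T_ε(Y_ε) = ε⁻² ∑_j ϰ_{εj}² y_{εj}² - ρ_ε²` as a function of the
observations `y = (y_{εj})_j`. -/
def testStat (ϰ : ℝ → ℕ+ → ℝ) (ε : ℝ) (y : ℕ+ → ℝ) : ℝ :=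
  (ε ^ 2)⁻¹ * ∑' j, ϰ ε j ^ 2 * y j ^ 2 - rhoSq ϰ ε

/-- The rejection region of the test `L_ε = 1{A_ε^{-1/2} T_ε > x}` with critical value `x`. -/
def rejects (ϰ : ℝ → ℕ+ → ℝ) (ε x : ℝ) : Set (ℕ+ → ℝ) :=
  {y | x < (√(normA ϰ ε))⁻¹ * testStat ϰ ε y}

/-- Type I error probability `α(L_ε) = E₀ L_ε`. -/
def typeI {Ω : Type*} [MeasurableSpace Ω] (P : Measure Ω) (W : L2 → Ω → ℝ) (φ : ℕ+ → L2)
    (ϰ : ℝ → ℕ+ → ℝ) (ε x : ℝ) : ℝ :=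
  P.real {ω | (fun j => observation W φ ε 0 j ω) ∈ rejects ϰ ε x}

/-- Type II error probability `β(L_ε, S) = E_S (1 - L_ε)`. -/
def typeII {Ω : Type*} [MeasurableSpace Ω] (P : Measure Ω) (W : L2 → Ω → ℝ) (φ : ℕ+ → L2)
    (ϰ : ℝ → ℕ+ → ℝ) (ε x : ℝ) (S : L2) : ℝ :=
  P.real {ω | (fun j => observation W φ ε S j ω) ∉ rejects ϰ ε x}

/-- The family of alternatives `S_ε` is `R_ε`-LD consistent for the tests generated by the
statistics `T_ε`: for every choice of the critical values `x_ε` such that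
`R_ε⁻² log α(L_ε) → 0`, one has `|log β(L_ε, S_ε)| = Ω(R_ε²)` as `ε → 0`.
Here `|log 0| = ∞`, which is why `α > 0` is required and `β = 0` is allowed separately. -/
def IsLDConsistent {Ω : Type*} [MeasurableSpace Ω] (P : Measure Ω) (W : L2 → Ω → ℝ)
    (φ : ℕ+ → L2) (ϰ : ℝ → ℕ+ → ℝ) (R : ℝ → ℝ) (S : ℝ → L2) : Prop :=
  ∀ x : ℝ → ℝ,
    (∀ᶠ ε in 𝓝[>] 0, 0 < typeI P W φ ϰ ε (x ε)) →
    Tendsto (fun ε => (R ε ^ 2)⁻¹ * Real.log (typeI P W φ ϰ ε (x ε))) (𝓝[>] 0) (𝓝 0) →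
    ∃ c > 0, ∀ᶠ ε in 𝓝[>] 0,
      typeII P W φ ϰ ε (x ε) (S ε) = 0 ∨
        c * R ε ^ 2 ≤ |Real.log (typeII P W φ ϰ ε (x ε) (S ε))|

end SignalDetection

end

/-!
Under the signal `S`, `ε⁻² (T_ε + ρ_ε²)` is a weighted sum `∑ v_j Z_j²` of squares of independent
Gaussians of variance `1` and mean `θ_j / ε`, where the weights `v_j = ϰ_{εj}² / ε²` satisfy
`∑ v_j² = A_ε ≍ 1`. The signal displaces the expectation of this sum by the energy
`E = ∑ v_j (θ_j / ε)²`. As long as `R v_1 → 0`, exponential moments of order `R` are available: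
Chebyshev's inequality bounds both error probabilities from above at the scale `exp (-c R²)`, and
the Paley–Zygmund inequality, applied to an exponential of the sum, bounds them from below. Hence
`R`-LD consistency means exactly `R = O(E)`; its necessity is seen from the critical value `0`.

By A1–A4 all the weights are of order at most `k_ε^{-1/2}`, this order is attained on `j < c k_ε`
for each fixed `c`, and for `j ≥ c k_ε` the weights are smaller by a factor that is small with
`1 / c`. So `E` is comparable to `k_ε^{-1/2} ε⁻²` times the energy of the signal below `c k_ε`, up
to a tail that is negligible against `k_ε^{-1/2} ε⁻² ‖S‖² ≍ R` once `c` is large.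
-/

noncomputable section

namespace SignalDetection

lemma integral_exp_mul_add_sq_gaussianReal {c : ℝ} (hc : 2 * c < 1) (m : ℝ) :
    ∫ x, Real.exp (c * (x + m) ^ 2) ∂(gaussianReal 0 1) =
      Real.exp (c * m ^ 2 / (1 - 2 * c)) / √(1 - 2 * c) := by
  have hp : 0 < 1 - 2 * c := by linarith
  have complete_square : ∀ x : ℝ, gaussianPDFReal 0 1 x • Real.exp (c * (x + m) ^ 2) =
      ((√(2 * Real.pi))⁻¹ * Real.exp (c * m ^ 2 / (1 - 2 * c))) *
        Real.exp (-((1 - 2 * c) / 2) * (x - 2 * c * m / (1 - 2 * c)) ^ 2) := by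
    intro x
    simp only [gaussianPDFReal_def, smul_eq_mul, NNReal.coe_one, mul_one, sub_zero]
    rw [mul_assoc, mul_assoc, ← Real.exp_add, ← Real.exp_add]
    congr 2
    field_simp
    ring
  have hsqrt : √(Real.pi / ((1 - 2 * c) / 2)) = √(2 * Real.pi) / √(1 - 2 * c) := by
    rw [← Real.sqrt_div (by positivity)]
    congr 1
    field_simp
  rw [integral_gaussianReal_eq_integral_smul one_ne_zero]
  simp_rw [complete_square]
  rw [integral_const_mul,
    integral_sub_right_eq_self (fun x => Real.exp (-((1 - 2 * c) / 2) * x ^ 2)),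
    integral_gaussian, hsqrt]
  field_simp

lemma exp_div_sqrt_eq_exp_sub {y : ℝ} (hy : 0 < y) (a : ℝ) :
    Real.exp a / √y = Real.exp (a - Real.log y / 2) := by
  rw [Real.exp_sub, Real.exp_half, Real.exp_log hy]

lemma exp_le_exp_div_sqrt_one_sub {x : ℝ} (hx : |x| ≤ 1 / 16) (m : ℝ) :
    Real.exp (x + x ^ 2 / 2 + x * m ^ 2) ≤
      Real.exp (x * m ^ 2 / (1 - 2 * x)) / √(1 - 2 * x) := by
  have hpos : 0 < 1 - 2 * x := by linarith [le_abs_self x]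
  have habs : |2 * x| = 2 * |x| := by rw [abs_mul, abs_two]
  have hlog := Real.abs_log_sub_add_sum_range_le (x := 2 * x) (by linarith) 2
  have hrem : |2 * x| ^ 3 / (1 - |2 * x|) ≤ x ^ 2 := by
    rw [habs, ← sq_abs x, div_le_iff₀ (by linarith)]
    nlinarith [mul_nonneg (sq_nonneg |x|) (sub_nonneg.2 hx)]
  have hmean : x * m ^ 2 ≤ x * m ^ 2 / (1 - 2 * x) := by
    rw [le_div_iff₀ hpos]
    nlinarith [sq_nonneg (x * m)]
  rw [exp_div_sqrt_eq_exp_sub hpos, Real.exp_le_exp]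
  norm_num [Finset.sum_range_succ] at hlog hrem
  linarith [(abs_le.1 hlog).2]

lemma exp_div_sqrt_one_sub_le_exp {x : ℝ} (hx : |x| ≤ 1 / 4) (m : ℝ) :
    Real.exp (x * m ^ 2 / (1 - 2 * x)) / √(1 - 2 * x) ≤
      Real.exp (x + 4 * x ^ 2 + (x + 4 * x ^ 2) * m ^ 2) := by
  have hpos : 1 / 2 ≤ 1 - 2 * x := by linarith [le_abs_self x]
  have habs : |2 * x| = 2 * |x| := by rw [abs_mul, abs_two]
  have hlog := Real.abs_log_sub_add_sum_range_le (x := 2 * x) (by linarith) 1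
  have hrem : |2 * x| ^ 2 / (1 - |2 * x|) ≤ 8 * x ^ 2 := by
    rw [habs, ← sq_abs x, div_le_iff₀ (by linarith)]
    nlinarith [mul_nonneg (sq_nonneg |x|) (sub_nonneg.2 hx)]
  have hmean : x * m ^ 2 / (1 - 2 * x) ≤ (x + 4 * x ^ 2) * m ^ 2 := by
    rw [div_le_iff₀ (by linarith)]
    nlinarith [mul_nonneg (sq_nonneg (x * m)) (sub_nonneg.2 hpos)]
  rw [exp_div_sqrt_eq_exp_sub (by linarith), Real.exp_le_exp]
  norm_num [Finset.sum_range_succ] at hlog hrem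
  linarith [(abs_le.1 hlog).1]

section PaleyZygmund

variable {Ω : Type*} [MeasurableSpace Ω] {P : Measure Ω} [IsProbabilityMeasure P]

lemma sq_integral_sub_le_integral_sq_mul_measureReal {Z : Ω → ℝ} (hZ : MemLp Z 2 P) {c : ℝ}
    (hc : 0 ≤ c) (hcZ : c ≤ ∫ ω, Z ω ∂P) :
    (∫ ω, Z ω ∂P - c) ^ 2 ≤ (∫ ω, Z ω ^ 2 ∂P) * P.real {ω | c < Z ω} := by
  have hE : NullMeasurableSet {ω | c < Z ω} P :=
    nullMeasurableSet_lt aemeasurable_const hZ.1.aemeasurable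
  have hZ1 : Integrable Z P := hZ.integrable one_le_two
  have hquad (t : ℝ) : 0 ≤ (∫ ω, Z ω ^ 2 ∂P) * (t * t) + -(2 * (∫ ω, Z ω ∂P - c)) * t
      + P.real {ω | c < Z ω} := by
    rcases le_total t 0 with ht | ht
    · have := mul_nonneg (sub_nonneg.2 hcZ) (neg_nonneg.2 ht)
      have hsq : 0 ≤ ∫ ω, Z ω ^ 2 ∂P := integral_nonneg fun ω => sq_nonneg _
      nlinarith [mul_nonneg hsq (mul_self_nonneg t),
        measureReal_nonneg (μ := P) (s := {ω | c < Z ω})]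
    have hpt (ω : Ω) : 2 * t * (Z ω - c) ≤
        t ^ 2 * Z ω ^ 2 + {ω | c < Z ω}.indicator (fun _ => 1) ω := by
      by_cases hω : c < Z ω
      · rw [Set.indicator_of_mem (by exact hω)]
        nlinarith [sq_nonneg (t * Z ω - 1), mul_nonneg ht hc]
      · rw [Set.indicator_of_notMem (by exact hω)]
        nlinarith [mul_nonneg ht (sub_nonneg.2 (not_lt.1 hω)), sq_nonneg (t * Z ω)]
    have hint := integral_mono ((hZ1.sub (integrable_const c)).const_mul (2 * t))
      ((hZ.integrable_sq.const_mul (t ^ 2)).add ((integrable_const (1 : ℝ)).indicator₀ hE)) hpt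
    simp only [Pi.sub_apply] at hint
    rw [integral_const_mul, integral_sub hZ1 (integrable_const c),
      integral_add' (hZ.integrable_sq.const_mul (t ^ 2))
        ((integrable_const (1 : ℝ)).indicator₀ hE),
      integral_const_mul, integral_indicator₀ hE] at hint
    simp only [integral_const, probReal_univ, measureReal_restrict_apply_univ, smul_eq_mul,
      mul_one] at hint
    linarith
  have hdiscrim := discrim_le_zero hquad
  rw [discrim] at hdiscrim
  linarith

lemma mgf_sq_le_four_mul_mgf_two_mul_mul_measureReal {X : Ω → ℝ} {s u : ℝ} (hs : 0 ≤ s)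
    (hX : AEMeasurable X P) (hint : Integrable (fun ω => Real.exp (2 * s * X ω)) P)
    (hu : 2 * Real.exp (s * u) ≤ mgf X P s) :
    mgf X P s ^ 2 ≤ 4 * mgf X P (2 * s) * P.real {ω | u < X ω} := by
  have hsq (ω : Ω) : Real.exp (s * X ω) ^ 2 = Real.exp (2 * s * X ω) := by
    rw [← Real.exp_nat_mul]; ring_nf
  have hL2 : MemLp (fun ω => Real.exp (s * X ω)) 2 P :=
    (memLp_two_iff_integrable_sq (hX.const_mul s).exp.aestronglyMeasurable).2 (by simpa only [hsq])
  have hPZ := sq_integral_sub_le_integral_sq_mul_measureReal hL2 (Real.exp_pos (s * u)).le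
    (by rw [mgf] at hu; linarith [Real.exp_pos (s * u)])
  simp only [hsq, Real.exp_lt_exp] at hPZ
  have hsub : P.real {ω | s * u < s * X ω} ≤ P.real {ω | u < X ω} :=
    measureReal_mono fun ω hω => lt_of_mul_lt_mul_left hω hs
  have hhalf : mgf X P s / 2 ≤ mgf X P s - Real.exp (s * u) := by linarith
  calc mgf X P s ^ 2 = 4 * (mgf X P s / 2) ^ 2 := by ring
    _ ≤ 4 * (mgf X P s - Real.exp (s * u)) ^ 2 := by gcongr; exact div_nonneg mgf_nonneg two_pos.le
    _ ≤ 4 * (mgf X P (2 * s) * P.real {ω | s * u < s * X ω}) := by gcongr; exact hPZ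
    _ ≤ 4 * mgf X P (2 * s) * P.real {ω | u < X ω} := by
      rw [← mul_assoc]; gcongr; exact mul_nonneg four_pos.le mgf_nonneg

end PaleyZygmund

section WeightedChiSq

variable {Ω ι : Type*} [MeasurableSpace Ω] {P : Measure Ω} {ξ : ι → Ω → ℝ} {b m : ι → ℝ} {s : ℝ}

lemma mgf_sum_weighted_sq (hind : iIndepFun ξ P) (hlaw : ∀ j, HasLaw (ξ j) (gaussianReal 0 1) P)
    (F : Finset ι) (hs : ∀ j, 2 * (s * b j) < 1) :
    mgf (fun ω => ∑ j ∈ F, b j * (ξ j ω + m j) ^ 2) P s =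
      ∏ j ∈ F, Real.exp (s * b j * m j ^ 2 / (1 - 2 * (s * b j))) / √(1 - 2 * (s * b j)) := by
  have hmeas (j : ι) : AEMeasurable (fun ω => b j * (ξ j ω + m j) ^ 2) P := by
    have := (hlaw j).aemeasurable
    fun_prop
  have hindep : iIndepFun (fun j ω => b j * (ξ j ω + m j) ^ 2) P :=
    hind.comp (fun j x => b j * (x + m j) ^ 2) fun j => by fun_prop
  rw [← Finset.sum_fn, hindep.mgf_sum₀ hmeas F]
  refine Finset.prod_congr rfl fun j _ => ?_
  rw [← integral_exp_mul_add_sq_gaussianReal (hs j), ← (hlaw j).map_eq,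
    integral_map (hlaw j).aemeasurable (by fun_prop)]
  simp only [mgf, mul_assoc]

lemma integrable_exp_mul_sum_weighted_sq (hind : iIndepFun ξ P)
    (hlaw : ∀ j, HasLaw (ξ j) (gaussianReal 0 1) P) (F : Finset ι)
    (hs : ∀ j, 2 * (s * b j) < 1) :
    Integrable (fun ω => Real.exp (s * ∑ j ∈ F, b j * (ξ j ω + m j) ^ 2)) P := by
  refine Integrable.of_integral_ne_zero (ne_of_eq_of_ne (mgf_sum_weighted_sq hind hlaw F hs) ?_)
  refine (Finset.prod_pos fun j _ => ?_).ne'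
  have : 0 < 1 - 2 * (s * b j) := by linarith [hs j]
  positivity

lemma exp_le_mgf_sum_weighted_sq (hind : iIndepFun ξ P)
    (hlaw : ∀ j, HasLaw (ξ j) (gaussianReal 0 1) P) (F : Finset ι)
    (hs : ∀ j, |s * b j| ≤ 1 / 16) :
    Real.exp (s * ∑ j ∈ F, b j + s ^ 2 / 2 * ∑ j ∈ F, b j ^ 2 + s * ∑ j ∈ F, b j * m j ^ 2) ≤
      mgf (fun ω => ∑ j ∈ F, b j * (ξ j ω + m j) ^ 2) P s := by
  rw [mgf_sum_weighted_sq hind hlaw F fun j => by linarith [le_abs_self (s * b j), hs j]]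
  simp_rw [Finset.mul_sum, ← Finset.sum_add_distrib, Real.exp_sum]
  refine Finset.prod_le_prod (fun j _ => (Real.exp_pos _).le) fun j _ => ?_
  refine Eq.trans_le ?_ (exp_le_exp_div_sqrt_one_sub (hs j) (m j))
  ring_nf

lemma mgf_sum_weighted_sq_le_exp (hind : iIndepFun ξ P)
    (hlaw : ∀ j, HasLaw (ξ j) (gaussianReal 0 1) P) (F : Finset ι) (hb : ∀ j, 0 ≤ b j)
    (hs : ∀ j, |s * b j| ≤ 1 / 8) :
    mgf (fun ω => ∑ j ∈ F, b j * (ξ j ω + m j) ^ 2) P s ≤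
      Real.exp (s * ∑ j ∈ F, b j + 4 * s ^ 2 * ∑ j ∈ F, b j ^ 2
        + (s + |s| / 2) * ∑ j ∈ F, b j * m j ^ 2) := by
  rw [mgf_sum_weighted_sq hind hlaw F fun j => by linarith [le_abs_self (s * b j), hs j]]
  simp_rw [Finset.mul_sum, ← Finset.sum_add_distrib, Real.exp_sum]
  refine Finset.prod_le_prod (fun j _ => by positivity) fun j _ => ?_
  refine (exp_div_sqrt_one_sub_le_exp ((hs j).trans (by norm_num)) (m j)).trans
    (Real.exp_le_exp.2 ?_)
  have hsb : 4 * (s * b j) ^ 2 ≤ |s| / 2 * b j := by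
    have habs := hs j
    rw [abs_mul, abs_of_nonneg (hb j)] at habs
    rw [mul_pow, ← sq_abs s]
    nlinarith [mul_nonneg (abs_nonneg s) (hb j)]
  nlinarith [mul_le_mul_of_nonneg_right hsb (sq_nonneg (m j))]

lemma integrable_sq_of_hasLaw_gaussianReal {X : Ω → ℝ} (hX : HasLaw X (gaussianReal 0 1) P) :
    Integrable (fun ω => X ω ^ 2) P := by
  have h := memLp_id_gaussianReal (μ := 0) (v := 1) 2
  rw [← hX.map_eq] at h
  exact ((memLp_map_measure_iff (by fun_prop) hX.aemeasurable).1 h).integrable_sq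

lemma ae_summable_weighted_sq [Countable ι] (hlaw : ∀ j, HasLaw (ξ j) (gaussianReal 0 1) P)
    (hb : ∀ j, 0 ≤ b j) (hbs : Summable b) (hbm : Summable fun j => b j * m j ^ 2) :
    ∀ᵐ ω ∂P, Summable fun j => b j * (ξ j ω + m j) ^ 2 := by
  have hterm (j : ι) : ∫⁻ ω, ENNReal.ofReal (b j * ξ j ω ^ 2) ∂P = ENNReal.ofReal (b j) := by
    have hvar : ∫ ω, ξ j ω ^ 2 ∂P = 1 := by
      have h := variance_fun_id_gaussianReal (μ := 0) (v := 1)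
      rw [variance_of_integral_eq_zero (by fun_prop) (by simp), ← (hlaw j).map_eq,
        integral_map (hlaw j).aemeasurable (by fun_prop)] at h
      simpa only [NNReal.coe_one] using h
    rw [← ofReal_integral_eq_lintegral_ofReal
      ((integrable_sq_of_hasLaw_gaussianReal (hlaw j)).const_mul _)
      (ae_of_all _ fun ω => mul_nonneg (hb j) (sq_nonneg _)), integral_const_mul, hvar, mul_one]
  have hmeas (j : ι) : AEMeasurable (fun ω => ENNReal.ofReal (b j * ξ j ω ^ 2)) P := by
    have := (hlaw j).aemeasurable
    fun_prop
  have hfinite : ∫⁻ ω, ∑' j, ENNReal.ofReal (b j * ξ j ω ^ 2) ∂P ≠ ⊤ := by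
    rw [lintegral_tsum hmeas]
    simp_rw [hterm]
    exact hbs.tsum_ofReal_ne_top
  filter_upwards [ae_lt_top' (AEMeasurable.tsum hmeas) hfinite] with ω hω
  have hcentral : Summable fun j => b j * ξ j ω ^ 2 :=
    (ENNReal.summable_toReal hω.ne).congr fun j =>
      ENNReal.toReal_ofReal (mul_nonneg (hb j) (sq_nonneg _))
  refine Summable.of_nonneg_of_le (fun j => mul_nonneg (hb j) (sq_nonneg _)) (fun j => ?_)
    ((hcentral.mul_left 2).add (hbm.mul_left 2))
  nlinarith [mul_nonneg (hb j) (sq_nonneg (ξ j ω - m j))]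

lemma summable_sq_of_nonneg_of_summable (hb : ∀ j, 0 ≤ b j) (hbs : Summable b) :
    Summable fun j => b j ^ 2 := by
  simpa only [sq] using!
    (hbs.mul_of_nonneg hbs hb hb).comp_injective Function.diag_injective

lemma tendsto_exp_sum_add_sum_add_sum {f g h : ι → ℝ} (hf : Summable f) (hg : Summable g)
    (hh : Summable h) (p q r : ℝ) :
    Tendsto (fun F : Finset ι =>
        Real.exp (p * ∑ j ∈ F, f j + q * ∑ j ∈ F, g j + r * ∑ j ∈ F, h j)) atTop
      (𝓝 (Real.exp (p * ∑' j, f j + q * ∑' j, g j + r * ∑' j, h j))) :=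
  (Real.continuous_exp.tendsto _).comp
    (((hf.hasSum.const_mul p).add (hg.hasSum.const_mul q)).add (hh.hasSum.const_mul r))

lemma integrable_of_ae_tendsto_of_eventually_integral_le {κ : Type*} {l : Filter κ} [l.NeBot]
    [l.IsCountablyGenerated] {f : κ → Ω → ℝ} {g : Ω → ℝ} {K : ℝ} (hf : ∀ i, Integrable (f i) P)
    (hf0 : ∀ i ω, 0 ≤ f i ω) (hg : ∀ᵐ ω ∂P, Tendsto (fun i => f i ω) l (𝓝 (g ω)))
    (hK : ∀ᶠ i in l, ∫ ω, f i ω ∂P ≤ K) : Integrable g P := by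
  have hg0 : 0 ≤ᵐ[P] g := hg.mono fun ω hω => ge_of_tendsto' hω fun i => hf0 i ω
  have hgm := aestronglyMeasurable_of_tendsto_ae l (fun i => (hf i).aestronglyMeasurable) hg
  refine (lintegral_ofReal_ne_top_iff_integrable hgm hg0).1
    (ne_top_of_le_ne_top (b := ENNReal.ofReal K) ENNReal.ofReal_ne_top ?_)
  calc ∫⁻ ω, ENNReal.ofReal (g ω) ∂P
      = ∫⁻ ω, liminf (fun i => ENNReal.ofReal (f i ω)) l ∂P :=
        lintegral_congr_ae (hg.mono fun ω hω => (ENNReal.tendsto_ofReal hω).liminf_eq.symm)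
    _ ≤ liminf (fun i => ∫⁻ ω, ENNReal.ofReal (f i ω) ∂P) l :=
        lintegral_liminf_le' fun i => (hf i).aemeasurable.ennreal_ofReal
    _ ≤ ENNReal.ofReal K := liminf_le_of_frequently_le' (hK.mono fun i hi => by
        rw [← ofReal_integral_eq_lintegral_ofReal (hf i) (ae_of_all _ (hf0 i))]
        exact ENNReal.ofReal_le_ofReal hi).frequently

/-- The weighted noncentral chi-square sum `∑ b_j (ξ_j + m_j)²`, which up to centring and scaling
is the test statistic; it takes the junk value `0` where the series diverges. -/
def weightedChiSq (ξ : ι → Ω → ℝ) (b m : ι → ℝ) (ω : Ω) : ℝ := ∑' j, b j * (ξ j ω + m j) ^ 2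

variable [Countable ι]

lemma aemeasurable_weightedChiSq (hlaw : ∀ j, HasLaw (ξ j) (gaussianReal 0 1) P)
    (hb : ∀ j, 0 ≤ b j) (hbs : Summable b) (hbm : Summable fun j => b j * m j ^ 2) :
    AEMeasurable (weightedChiSq ξ b m) P := by
  refine aemeasurable_of_tendsto_metrizable_ae (atTop : Filter (Finset ι))
    (f := fun F ω => ∑ j ∈ F, b j * (ξ j ω + m j) ^ 2) (fun F => ?_) ?_
  · refine Finset.aemeasurable_fun_sum F fun j _ => ?_
    have := (hlaw j).aemeasurable
    fun_prop
  · filter_upwards [ae_summable_weighted_sq hlaw hb hbs hbm] with ω hω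
    exact hω.hasSum

lemma integrable_exp_mul_weightedChiSq (hind : iIndepFun ξ P)
    (hlaw : ∀ j, HasLaw (ξ j) (gaussianReal 0 1) P) (hb : ∀ j, 0 ≤ b j) (hbs : Summable b)
    (hbm : Summable fun j => b j * m j ^ 2) (hs : ∀ j, |s * b j| ≤ 1 / 8) :
    Integrable (fun ω => Real.exp (s * weightedChiSq ξ b m ω)) P := by
  refine integrable_of_ae_tendsto_of_eventually_integral_le (l := (atTop : Filter (Finset ι)))
    (fun F => integrable_exp_mul_sum_weighted_sq (m := m) hind hlaw F fun j => ?_)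
    (fun F ω => (Real.exp_pos _).le) ?_
    (((tendsto_exp_sum_add_sum_add_sum hbs (summable_sq_of_nonneg_of_summable hb hbs) hbm
      s (4 * s ^ 2) (s + |s| / 2)).eventually_le_const (lt_add_one _)).mono
      fun F hF => (mgf_sum_weighted_sq_le_exp hind hlaw F hb hs).trans hF)
  · linarith [le_abs_self (s * b j), hs j]
  · filter_upwards [ae_summable_weighted_sq hlaw hb hbs hbm] with ω hω
    exact (Real.continuous_exp.tendsto _).comp (Tendsto.const_mul s hω.hasSum)

lemma tendsto_mgf_sum_weighted_sq (hind : iIndepFun ξ P)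
    (hlaw : ∀ j, HasLaw (ξ j) (gaussianReal 0 1) P) (hb : ∀ j, 0 ≤ b j) (hbs : Summable b)
    (hbm : Summable fun j => b j * m j ^ 2) (hs : ∀ j, |s * b j| ≤ 1 / 8) :
    Tendsto (fun F : Finset ι => mgf (fun ω => ∑ j ∈ F, b j * (ξ j ω + m j) ^ 2) P s) atTop
      (𝓝 (mgf (weightedChiSq ξ b m) P s)) := by
  have hae := ae_summable_weighted_sq hlaw hb hbs hbm
  refine tendsto_integral_filter_of_dominated_convergence
    (fun ω => Real.exp (|s| * weightedChiSq ξ b m ω)) (Eventually.of_forall fun F => ?_)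
    (Eventually.of_forall fun F => ?_)
    (integrable_exp_mul_weightedChiSq hind hlaw hb hbs hbm fun j => ?_) ?_
  · have (j : ι) := (hlaw j).aemeasurable
    fun_prop
  · filter_upwards [hae] with ω hω
    have hpos (j : ι) : 0 ≤ b j * (ξ j ω + m j) ^ 2 := mul_nonneg (hb j) (sq_nonneg _)
    rw [Real.norm_of_nonneg (Real.exp_pos _).le, Real.exp_le_exp]
    exact mul_le_mul (le_abs_self s) (hω.sum_le_tsum F fun j _ => hpos j)
      (Finset.sum_nonneg fun j _ => hpos j) (abs_nonneg s)
  · simpa only [abs_mul, abs_abs] using hs j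
  · filter_upwards [hae] with ω hω
    exact (Real.continuous_exp.tendsto _).comp (Tendsto.const_mul s hω.hasSum)

lemma mgf_weightedChiSq_le_exp (hind : iIndepFun ξ P)
    (hlaw : ∀ j, HasLaw (ξ j) (gaussianReal 0 1) P) (hb : ∀ j, 0 ≤ b j) (hbs : Summable b)
    (hbm : Summable fun j => b j * m j ^ 2) (hs : ∀ j, |s * b j| ≤ 1 / 8) :
    mgf (weightedChiSq ξ b m) P s ≤
      Real.exp (s * ∑' j, b j + 4 * s ^ 2 * ∑' j, b j ^ 2
        + (s + |s| / 2) * ∑' j, b j * m j ^ 2) :=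
  le_of_tendsto_of_tendsto' (tendsto_mgf_sum_weighted_sq hind hlaw hb hbs hbm hs)
    (tendsto_exp_sum_add_sum_add_sum hbs (summable_sq_of_nonneg_of_summable hb hbs) hbm _ _ _)
    fun F => mgf_sum_weighted_sq_le_exp hind hlaw F hb hs

lemma exp_le_mgf_weightedChiSq (hind : iIndepFun ξ P)
    (hlaw : ∀ j, HasLaw (ξ j) (gaussianReal 0 1) P) (hb : ∀ j, 0 ≤ b j) (hbs : Summable b)
    (hbm : Summable fun j => b j * m j ^ 2) (hs : ∀ j, |s * b j| ≤ 1 / 16) :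
    Real.exp (s * ∑' j, b j + s ^ 2 / 2 * ∑' j, b j ^ 2 + s * ∑' j, b j * m j ^ 2) ≤
      mgf (weightedChiSq ξ b m) P s :=
  le_of_tendsto_of_tendsto'
    (tendsto_exp_sum_add_sum_add_sum hbs (summable_sq_of_nonneg_of_summable hb hbs) hbm _ _ _)
    (tendsto_mgf_sum_weighted_sq hind hlaw hb hbs hbm fun j => (hs j).trans (by norm_num))
    fun F => exp_le_mgf_sum_weighted_sq hind hlaw F hs

variable {t : ℝ}

lemma measureReal_lt_weightedChiSq_le [IsFiniteMeasure P] (hind : iIndepFun ξ P)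
    (hlaw : ∀ j, HasLaw (ξ j) (gaussianReal 0 1) P) (hb : ∀ j, 0 ≤ b j) (hbs : Summable b)
    (hbm : Summable fun j => b j * m j ^ 2) (hs0 : 0 ≤ s) (hs : ∀ j, s * b j ≤ 1 / 8) :
    P.real {ω | ∑' j, b j + t < weightedChiSq ξ b m ω} ≤
      Real.exp (-(s * t) + 4 * s ^ 2 * ∑' j, b j ^ 2 + 3 / 2 * s * ∑' j, b j * m j ^ 2) := by
  have habs (j : ι) : |s * b j| ≤ 1 / 8 := by rw [abs_of_nonneg (mul_nonneg hs0 (hb j))]; exact hs j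
  calc P.real {ω | ∑' j, b j + t < weightedChiSq ξ b m ω}
      ≤ P.real {ω | ∑' j, b j + t ≤ weightedChiSq ξ b m ω} :=
        measureReal_mono (Set.ofPred_subset_ofPred.2 fun _ => le_of_lt)
    _ ≤ Real.exp (-s * (∑' j, b j + t)) * mgf (weightedChiSq ξ b m) P s :=
        measure_ge_le_exp_mul_mgf _ hs0
          (integrable_exp_mul_weightedChiSq hind hlaw hb hbs hbm habs)
    _ ≤ Real.exp (-s * (∑' j, b j + t)) * _ :=
        mul_le_mul_of_nonneg_left (mgf_weightedChiSq_le_exp hind hlaw hb hbs hbm habs)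
          (Real.exp_pos _).le
    _ = _ := by
        rw [← Real.exp_add, abs_of_nonneg hs0]
        ring_nf

lemma measureReal_weightedChiSq_le_le [IsFiniteMeasure P] (hind : iIndepFun ξ P)
    (hlaw : ∀ j, HasLaw (ξ j) (gaussianReal 0 1) P) (hb : ∀ j, 0 ≤ b j) (hbs : Summable b)
    (hbm : Summable fun j => b j * m j ^ 2) (hs0 : 0 ≤ s) (hs : ∀ j, s * b j ≤ 1 / 8) :
    P.real {ω | weightedChiSq ξ b m ω ≤ ∑' j, b j + t} ≤
      Real.exp (s * t + 4 * s ^ 2 * ∑' j, b j ^ 2 - s / 2 * ∑' j, b j * m j ^ 2) := by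
  have habs (j : ι) : |-s * b j| ≤ 1 / 8 := by
    rw [neg_mul, abs_neg, abs_of_nonneg (mul_nonneg hs0 (hb j))]; exact hs j
  calc P.real {ω | weightedChiSq ξ b m ω ≤ ∑' j, b j + t}
      ≤ Real.exp (-(-s) * (∑' j, b j + t)) * mgf (weightedChiSq ξ b m) P (-s) :=
        measure_le_le_exp_mul_mgf _ (neg_nonpos.2 hs0)
          (integrable_exp_mul_weightedChiSq hind hlaw hb hbs hbm habs)
    _ ≤ Real.exp (-(-s) * (∑' j, b j + t)) * _ :=
        mul_le_mul_of_nonneg_left (mgf_weightedChiSq_le_exp hind hlaw hb hbs hbm habs)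
          (Real.exp_pos _).le
    _ = _ := by
        rw [← Real.exp_add, abs_neg, abs_of_nonneg hs0]
        ring_nf

lemma exp_mul_mgf_two_mul_weightedChiSq_le_mgf_sq (hind : iIndepFun ξ P)
    (hlaw : ∀ j, HasLaw (ξ j) (gaussianReal 0 1) P) (hb : ∀ j, 0 ≤ b j) (hbs : Summable b)
    (hbm : Summable fun j => b j * m j ^ 2) (hs : ∀ j, |s * b j| ≤ 1 / 16) :
    Real.exp (-(15 * s ^ 2 * ∑' j, b j ^ 2) - |s| * ∑' j, b j * m j ^ 2) *
      mgf (weightedChiSq ξ b m) P (2 * s) ≤ mgf (weightedChiSq ξ b m) P s ^ 2 := by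
  have hs2 (j : ι) : |2 * s * b j| ≤ 1 / 8 := by
    rw [mul_assoc, abs_mul, abs_two]; linarith [hs j]
  calc _ ≤ Real.exp (-(15 * s ^ 2 * ∑' j, b j ^ 2) - |s| * ∑' j, b j * m j ^ 2) * _ :=
        mul_le_mul_of_nonneg_left (mgf_weightedChiSq_le_exp hind hlaw hb hbs hbm hs2)
          (Real.exp_pos _).le
    _ = Real.exp (s * ∑' j, b j + s ^ 2 / 2 * ∑' j, b j ^ 2 + s * ∑' j, b j * m j ^ 2) ^ 2 := by
        rw [← Real.exp_add, ← Real.exp_nat_mul, abs_mul, abs_two]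
        push_cast
        ring_nf
    _ ≤ mgf (weightedChiSq ξ b m) P s ^ 2 := by
        gcongr
        exact exp_le_mgf_weightedChiSq hind hlaw hb hbs hbm hs

lemma two_mul_exp_le_exp {x y : ℝ} (h : x + Real.log 2 ≤ y) : 2 * Real.exp x ≤ Real.exp y := by
  rwa [← Real.exp_le_exp, Real.exp_add, Real.exp_log two_pos, mul_comm] at h

lemma exp_div_four_le_measureReal_lt_weightedChiSq [IsProbabilityMeasure P]
    (hind : iIndepFun ξ P) (hlaw : ∀ j, HasLaw (ξ j) (gaussianReal 0 1) P) (hb : ∀ j, 0 ≤ b j)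
    (hbs : Summable b) (hbm : Summable fun j => b j * m j ^ 2) (hs0 : 0 ≤ s)
    (hs : ∀ j, s * b j ≤ 1 / 16)
    (ht : s * t + Real.log 2 ≤ s ^ 2 / 2 * ∑' j, b j ^ 2 + s * ∑' j, b j * m j ^ 2) :
    Real.exp (-(15 * s ^ 2 * ∑' j, b j ^ 2) - s * ∑' j, b j * m j ^ 2) / 4 ≤
      P.real {ω | ∑' j, b j + t < weightedChiSq ξ b m ω} := by
  have habs (j : ι) : |s * b j| ≤ 1 / 16 := by
    rw [abs_of_nonneg (mul_nonneg hs0 (hb j))]; exact hs j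
  have hint := integrable_exp_mul_weightedChiSq (s := 2 * s) hind hlaw hb hbs hbm fun j => by
    rw [mul_assoc, abs_mul, abs_two]; linarith [habs j]
  have hmgf : 2 * Real.exp (s * (∑' j, b j + t)) ≤ mgf (weightedChiSq ξ b m) P s :=
    (two_mul_exp_le_exp (by linarith)).trans
      (exp_le_mgf_weightedChiSq hind hlaw hb hbs hbm habs)
  have hPZ := (exp_mul_mgf_two_mul_weightedChiSq_le_mgf_sq hind hlaw hb hbs hbm habs).trans
    (mgf_sq_le_four_mul_mgf_two_mul_mul_measureReal hs0
      (aemeasurable_weightedChiSq hlaw hb hbs hbm) hint hmgf)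
  rw [abs_of_nonneg hs0] at hPZ
  refine le_of_mul_le_mul_right ?_ (mgf_pos hint)
  linarith

lemma exp_div_four_le_measureReal_weightedChiSq_le [IsProbabilityMeasure P]
    (hind : iIndepFun ξ P) (hlaw : ∀ j, HasLaw (ξ j) (gaussianReal 0 1) P) (hb : ∀ j, 0 ≤ b j)
    (hbs : Summable b) (hbm : Summable fun j => b j * m j ^ 2) (hs0 : 0 ≤ s)
    (hs : ∀ j, s * b j ≤ 1 / 16)
    (ht : s * ∑' j, b j * m j ^ 2 + Real.log 2 ≤ s ^ 2 / 2 * ∑' j, b j ^ 2 + s * t) :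
    Real.exp (-(15 * s ^ 2 * ∑' j, b j ^ 2) - s * ∑' j, b j * m j ^ 2) / 4 ≤
      P.real {ω | weightedChiSq ξ b m ω ≤ ∑' j, b j + t} := by
  have habs (j : ι) : |-s * b j| ≤ 1 / 16 := by
    rw [neg_mul, abs_neg, abs_of_nonneg (mul_nonneg hs0 (hb j))]; exact hs j
  have hint := integrable_exp_mul_weightedChiSq (s := 2 * -s) hind hlaw hb hbs hbm fun j => by
    rw [mul_assoc, abs_mul, abs_two]; linarith [habs j]
  have hmgf : 2 * Real.exp (s * -(∑' j, b j + t)) ≤ mgf (-weightedChiSq ξ b m) P s := by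
    rw [mgf_neg]
    exact (two_mul_exp_le_exp (by linarith [neg_sq s])).trans
      (exp_le_mgf_weightedChiSq hind hlaw hb hbs hbm habs)
  have hPZ := mgf_sq_le_four_mul_mgf_two_mul_mul_measureReal hs0
    (aemeasurable_weightedChiSq hlaw hb hbs hbm).neg
    (hint.congr (ae_of_all _ fun ω => by simp only [Pi.neg_apply]; ring_nf)) hmgf
  rw [mgf_neg, mgf_neg, ← mul_neg] at hPZ
  have hbound := (exp_mul_mgf_two_mul_weightedChiSq_le_mgf_sq hind hlaw hb hbs hbm habs).trans hPZ
  rw [abs_neg, abs_of_nonneg hs0, neg_sq] at hbound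
  simp only [Pi.neg_apply, neg_lt_neg_iff] at hbound
  have hsub : P.real {ω | weightedChiSq ξ b m ω < ∑' j, b j + t} ≤
      P.real {ω | weightedChiSq ξ b m ω ≤ ∑' j, b j + t} :=
    measureReal_mono (Set.ofPred_subset_ofPred.2 fun _ => le_of_lt)
  refine le_trans (le_of_mul_le_mul_right ?_ (mgf_pos hint)) hsub
  linarith

end WeightedChiSq

section Tests

variable {Ω : Type*} {W : L2 → Ω → ℝ} {φ : ℕ+ → L2} {ϰ : ℝ → ℕ+ → ℝ} {ε : ℝ}

/-- The weights `ϰ_{εj}² / ε²` of the test statistic in terms of the normalised observations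
`y_{εj} / ε`. -/
def weight (ϰ : ℝ → ℕ+ → ℝ) (ε : ℝ) (j : ℕ+) : ℝ := ϰ ε j ^ 2 / ε ^ 2

/-- The means `θ_j / ε` of the normalised observations `y_{εj} / ε`. -/
def normMean (φ : ℕ+ → L2) (ε : ℝ) (S : L2) (j : ℕ+) : ℝ := fourierCoeff φ S j / ε

/-- The contribution of the signal to the mean of the weighted chi-square sum, which governs the
type II error probability. -/
def energy (φ : ℕ+ → L2) (ϰ : ℝ → ℕ+ → ℝ) (ε : ℝ) (S : L2) : ℝ :=
  ∑' j, weight ϰ ε j * normMean φ ε S j ^ 2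

/-- The critical value `x` of the test `L_ε` in the scale of the weighted chi-square sum, measured
from its mean under the zero signal. -/
def threshold (ϰ : ℝ → ℕ+ → ℝ) (ε x : ℝ) : ℝ := x * √(normA ϰ ε) / ε ^ 2

lemma weight_nonneg (ϰ : ℝ → ℕ+ → ℝ) (ε : ℝ) (j : ℕ+) : 0 ≤ weight ϰ ε j :=
  div_nonneg (sq_nonneg _) (sq_nonneg _)

lemma tsum_weight_sq (ϰ : ℝ → ℕ+ → ℝ) (ε : ℝ) : ∑' j, weight ϰ ε j ^ 2 = normA ϰ ε := by
  rw [normA, ← tsum_mul_left]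
  refine tsum_congr fun j => ?_
  rw [weight, div_pow, ← pow_mul, ← pow_mul, div_eq_inv_mul]

lemma normMean_zero (φ : ℕ+ → L2) (ε : ℝ) : normMean φ ε 0 = 0 := by
  ext j
  simp [normMean, fourierCoeff]

lemma threshold_zero (ϰ : ℝ → ℕ+ → ℝ) (ε : ℝ) : threshold ϰ ε 0 = 0 := by
  rw [threshold, zero_mul, zero_div]

lemma energy_nonneg (φ : ℕ+ → L2) (ϰ : ℝ → ℕ+ → ℝ) (ε : ℝ) (S : L2) : 0 ≤ energy φ ϰ ε S :=
  tsum_nonneg fun j => mul_nonneg (weight_nonneg ϰ ε j) (sq_nonneg _)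

lemma testStat_observation (W : L2 → Ω → ℝ) (φ : ℕ+ → L2) (ϰ : ℝ → ℕ+ → ℝ) (hε : 0 < ε) (S : L2)
    (ω : Ω) :
    testStat ϰ ε (fun j => observation W φ ε S j ω) = ε ^ 2 *
      (weightedChiSq (fun j => W (φ j)) (weight ϰ ε) (normMean φ ε S) ω - ∑' j, weight ϰ ε j) := by
  rw [testStat, rhoSq, weightedChiSq, mul_sub, ← tsum_mul_left, ← tsum_mul_left, ← tsum_mul_left]
  congr 1 <;> refine tsum_congr fun j => ?_
  · simp only [observation, weight, normMean]
    field_simp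
    ring
  · rw [weight]
    field_simp

lemma observation_mem_rejects_iff (W : L2 → Ω → ℝ) (φ : ℕ+ → L2) (hε : 0 < ε)
    (hA : 0 < normA ϰ ε) (x : ℝ) (S : L2) (ω : Ω) :
    (fun j => observation W φ ε S j ω) ∈ rejects ϰ ε x ↔
      ∑' j, weight ϰ ε j + threshold ϰ ε x <
        weightedChiSq (fun j => W (φ j)) (weight ϰ ε) (normMean φ ε S) ω := by
  rw [rejects, Set.mem_ofPred_eq, testStat_observation W φ ϰ hε, threshold, ← lt_sub_iff_add_lt',
    div_lt_iff₀' (by positivity), lt_inv_mul_iff₀' (Real.sqrt_pos.2 hA)]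

variable [MeasurableSpace Ω] {P : Measure Ω}

lemma IsWhiteNoise.hasLaw (hW : IsWhiteNoise P W) {f : L2} (hf : ‖f‖ = 1) :
    HasLaw (W f) (gaussianReal 0 1) P where
  aemeasurable := hW.isGaussianProcess.aemeasurable f
  map_eq := by
    have hvar : ∫ ω, W f ω ^ 2 ∂P = 1 := by
      simpa only [sq, real_inner_self_eq_norm_sq, hf, one_mul] using hW.covariance_eq f f
    rw [(hW.isGaussianProcess.hasGaussianLaw_eval f).map_eq_gaussianReal, hW.mean_eq_zero,
      variance_of_integral_eq_zero (hW.isGaussianProcess.aemeasurable f) (hW.mean_eq_zero f), hvar,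
      Real.toNNReal_one]

lemma IsWhiteNoise.iIndepFun [IsProbabilityMeasure P] (hW : IsWhiteNoise P W)
    (hφ : Orthonormal ℝ φ) : iIndepFun (fun j => W (φ j)) P := by
  have h : ProbabilityTheory.iIndepFun (fun (j : ℕ+) ω (_ : Unit) => W (φ j) ω) P := by
    refine IsGaussianProcess.iIndepFun_of_covariance_eq_zero (S := fun _ => Unit)
      (X := fun j _ => W (φ j))
      (hW.isGaussianProcess.comp_right fun p : (_ : ℕ+) × Unit => φ p.1)
      (fun j _ => hW.isGaussianProcess.aemeasurable _) fun i j hij _ _ => ?_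
    rw [covariance_eq_sub (hW.isGaussianProcess.hasGaussianLaw_eval _).memLp_two
      (hW.isGaussianProcess.hasGaussianLaw_eval _).memLp_two]
    simp only [hW.mean_eq_zero, mul_zero, sub_zero]
    exact (hW.covariance_eq _ _).trans (hφ.2 hij)
  exact h.comp (fun _ g => g ()) fun _ => measurable_pi_apply ()

lemma typeI_eq (P : Measure Ω) (W : L2 → Ω → ℝ) (φ : ℕ+ → L2) (hε : 0 < ε)
    (hA : 0 < normA ϰ ε) (x : ℝ) :
    typeI P W φ ϰ ε x = P.real {ω | ∑' j, weight ϰ ε j + threshold ϰ ε x <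
      weightedChiSq (fun j => W (φ j)) (weight ϰ ε) 0 ω} := by
  simp only [typeI, observation_mem_rejects_iff W φ hε hA, normMean_zero]

lemma typeII_eq (P : Measure Ω) (W : L2 → Ω → ℝ) (φ : ℕ+ → L2) (hε : 0 < ε)
    (hA : 0 < normA ϰ ε) (x : ℝ) (S : L2) :
    typeII P W φ ϰ ε x S =
      P.real {ω | weightedChiSq (fun j => W (φ j)) (weight ϰ ε) (normMean φ ε S) ω ≤
        ∑' j, weight ϰ ε j + threshold ϰ ε x} := by
  simp only [typeII, observation_mem_rejects_iff W φ hε hA, not_lt]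

namespace Conditions

lemma weight_antitone (hϰ : Conditions ϰ) (hε : 0 < ε) : Antitone (weight ϰ ε) := fun _ _ hij =>
  div_le_div_of_nonneg_right (hϰ.A1 ε hε hij) (sq_nonneg ε)

lemma weight_le_weight_one (hϰ : Conditions ϰ) (hε : 0 < ε) (j : ℕ+) :
    weight ϰ ε j ≤ weight ϰ ε 1 := hϰ.weight_antitone hε one_le

lemma summable_weight (hϰ : Conditions ϰ) (hε : 0 < ε) : Summable (weight ϰ ε) :=
  (hϰ.summable ε hε).div_const _

lemma normA_pos (hϰ : Conditions ϰ) (hε : 0 < ε) : 0 < normA ϰ ε := by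
  obtain ⟨C₁, hC₁, C₂, -, hA⟩ := hϰ.A2
  exact hC₁.trans (hA ε hε).1

end Conditions

lemma summable_fourierCoeff_sq (hφ : Orthonormal ℝ φ) (S : L2) :
    Summable fun j => fourierCoeff φ S j ^ 2 :=
  (hφ.inner_products_summable (x := S)).congr fun j => by
    rw [Real.norm_eq_abs, sq_abs, real_inner_comm, fourierCoeff]

lemma tsum_fourierCoeff_sq_le (hφ : Orthonormal ℝ φ) (S : L2) :
    ∑' j, fourierCoeff φ S j ^ 2 ≤ ‖S‖ ^ 2 := by
  refine (tsum_congr fun j => ?_).trans_le (hφ.tsum_inner_products_le (x := S))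
  rw [Real.norm_eq_abs, sq_abs, real_inner_comm, fourierCoeff]

lemma Conditions.summable_weight_mul_normMean_sq (hϰ : Conditions ϰ) (hφ : Orthonormal ℝ φ)
    (hε : 0 < ε) (S : L2) : Summable fun j => weight ϰ ε j * normMean φ ε S j ^ 2 := by
  refine Summable.of_nonneg_of_le (fun j => mul_nonneg (weight_nonneg ϰ ε j) (sq_nonneg _))
    (fun j => mul_le_mul_of_nonneg_right (hϰ.weight_le_weight_one hε j) (sq_nonneg _))
    (Summable.mul_left (weight ϰ ε 1) ?_)
  simp_rw [normMean, div_pow]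
  exact (summable_fourierCoeff_sq hφ S).div_const _

variable [IsProbabilityMeasure P] {s : ℝ}

lemma Conditions.mul_weight_le (hϰ : Conditions ϰ) (hε : 0 < ε) {c : ℝ} (hs0 : 0 ≤ s)
    (hs : s * weight ϰ ε 1 ≤ c) (j : ℕ+) : s * weight ϰ ε j ≤ c :=
  (mul_le_mul_of_nonneg_left (hϰ.weight_le_weight_one hε j) hs0).trans hs

lemma typeI_le_exp (hW : IsWhiteNoise P W) (hφ : Orthonormal ℝ φ) (hϰ : Conditions ϰ) (hε : 0 < ε)
    (hs0 : 0 ≤ s) (hs : s * weight ϰ ε 1 ≤ 1 / 8) (x : ℝ) :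
    typeI P W φ ϰ ε x ≤ Real.exp (-(s * threshold ϰ ε x) + 4 * s ^ 2 * normA ϰ ε) := by
  rw [typeI_eq P W φ hε (hϰ.normA_pos hε), ← tsum_weight_sq]
  refine (measureReal_lt_weightedChiSq_le (m := 0) (hW.iIndepFun hφ)
    (fun j => hW.hasLaw (hφ.1 j)) (weight_nonneg ϰ ε) (hϰ.summable_weight hε) (by simp) hs0
    (hϰ.mul_weight_le hε hs0 hs)).trans_eq (by simp)

lemma exp_div_four_le_typeI (hW : IsWhiteNoise P W) (hφ : Orthonormal ℝ φ) (hϰ : Conditions ϰ)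
    (hε : 0 < ε) (hs0 : 0 ≤ s) (hs : s * weight ϰ ε 1 ≤ 1 / 16) {x : ℝ}
    (hx : s * threshold ϰ ε x + Real.log 2 ≤ s ^ 2 / 2 * normA ϰ ε) :
    Real.exp (-(15 * s ^ 2 * normA ϰ ε)) / 4 ≤ typeI P W φ ϰ ε x := by
  rw [← tsum_weight_sq] at hx ⊢
  rw [typeI_eq P W φ hε (hϰ.normA_pos hε)]
  refine Eq.trans_le (by simp) (exp_div_four_le_measureReal_lt_weightedChiSq (m := 0)
    (hW.iIndepFun hφ) (fun j => hW.hasLaw (hφ.1 j)) (weight_nonneg ϰ ε) (hϰ.summable_weight hε)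
    (by simp) hs0 (hϰ.mul_weight_le hε hs0 hs) (by simpa using hx))

lemma typeII_le_exp (hW : IsWhiteNoise P W) (hφ : Orthonormal ℝ φ) (hϰ : Conditions ϰ) (hε : 0 < ε)
    (hs0 : 0 ≤ s) (hs : s * weight ϰ ε 1 ≤ 1 / 8) (x : ℝ) (S : L2) :
    typeII P W φ ϰ ε x S ≤ Real.exp
      (s * threshold ϰ ε x + 4 * s ^ 2 * normA ϰ ε - s / 2 * energy φ ϰ ε S) := by
  rw [typeII_eq P W φ hε (hϰ.normA_pos hε), ← tsum_weight_sq]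
  exact measureReal_weightedChiSq_le_le (hW.iIndepFun hφ) (fun j => hW.hasLaw (hφ.1 j))
    (weight_nonneg ϰ ε) (hϰ.summable_weight hε) (hϰ.summable_weight_mul_normMean_sq hφ hε S) hs0
    (hϰ.mul_weight_le hε hs0 hs)

lemma exp_div_four_le_typeII (hW : IsWhiteNoise P W) (hφ : Orthonormal ℝ φ) (hϰ : Conditions ϰ)
    (hε : 0 < ε) (hs0 : 0 ≤ s) (hs : s * weight ϰ ε 1 ≤ 1 / 16) {x : ℝ} {S : L2}
    (hx : s * energy φ ϰ ε S + Real.log 2 ≤ s ^ 2 / 2 * normA ϰ ε + s * threshold ϰ ε x) :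
    Real.exp (-(15 * s ^ 2 * normA ϰ ε) - s * energy φ ϰ ε S) / 4 ≤ typeII P W φ ϰ ε x S := by
  rw [← tsum_weight_sq] at hx ⊢
  rw [typeII_eq P W φ hε (hϰ.normA_pos hε)]
  exact exp_div_four_le_measureReal_weightedChiSq_le (hW.iIndepFun hφ)
    (fun j => hW.hasLaw (hφ.1 j)) (weight_nonneg ϰ ε) (hϰ.summable_weight hε)
    (hϰ.summable_weight_mul_normMean_sq hφ hε S) hs0 (hϰ.mul_weight_le hε hs0 hs) hx

end Tests

section LDConsistency

variable {Ω : Type*} [MeasurableSpace Ω] {P : Measure Ω} [IsProbabilityMeasure P]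
  {W : L2 → Ω → ℝ} {φ : ℕ+ → L2} {ϰ : ℝ → ℕ+ → ℝ} {R : ℝ → ℝ} {S : ℝ → L2}

lemma eq_zero_or_le_abs_log_of_le_exp_neg {p a : ℝ} (hp : 0 ≤ p) (h : p ≤ Real.exp (-a)) :
    p = 0 ∨ a ≤ |Real.log p| := by
  refine hp.eq_or_lt.imp Eq.symm fun hp => ?_
  have hlog : Real.log p ≤ -a := (Real.log_le_iff_le_exp hp).2 h
  linarith [neg_abs_le (Real.log p)]

lemma eventually_mul_weight_one_le
    (hRw : Tendsto (fun ε => R ε * weight ϰ ε 1) (𝓝[>] 0) (𝓝 0)) (η : ℝ) {c : ℝ} (hc : 0 < c) :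
    ∀ᶠ ε in 𝓝[>] 0, η * R ε * weight ϰ ε 1 ≤ c := by
  have h := hRw.const_mul η
  rw [mul_zero] at h
  filter_upwards [h.eventually_le_const hc] with ε hε
  rwa [mul_assoc]

lemma eventually_threshold_le (hW : IsWhiteNoise P W) (hφ : Orthonormal ℝ φ) (hϰ : Conditions ϰ)
    (hR : Tendsto R (𝓝[>] 0) atTop)
    (hRw : Tendsto (fun ε => R ε * weight ϰ ε 1) (𝓝[>] 0) (𝓝 0)) {x : ℝ → ℝ}
    (hpos : ∀ᶠ ε in 𝓝[>] 0, 0 < typeI P W φ ϰ ε (x ε))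
    (hlog : Tendsto (fun ε => (R ε ^ 2)⁻¹ * Real.log (typeI P W φ ϰ ε (x ε))) (𝓝[>] 0) (𝓝 0))
    {δ : ℝ} (hδ : 0 < δ) : ∀ᶠ ε in 𝓝[>] 0, threshold ϰ ε (x ε) ≤ δ * R ε := by
  obtain ⟨_, _, C, hC, hA⟩ := hϰ.A2
  obtain ⟨η, hη, hηC⟩ : ∃ η > 0, η * C = δ / 8 := ⟨δ / 8 / C, by positivity, by field_simp⟩
  filter_upwards [hpos,
    hlog.eventually_const_lt (u := -(η * δ / 4)) (neg_lt_zero.2 (by positivity)),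
    hR.eventually_gt_atTop 0, eventually_mul_weight_one_le hRw η (c := 1 / 8) (by norm_num),
    self_mem_nhdsWithin] with ε hpos hlog hRpos hw (hε : 0 < ε)
  by_contra! ht
  have hupper : Real.log (typeI P W φ ϰ ε (x ε)) ≤
      -(η * R ε * threshold ϰ ε (x ε)) + 4 * (η * R ε) ^ 2 * normA ϰ ε :=
    (Real.log_le_iff_le_exp hpos).2 (typeI_le_exp hW hφ hϰ hε (by positivity) hw _)
  rw [inv_mul_eq_div, lt_div_iff₀ (by positivity)] at hlog
  have hthreshold : η * R ε * (δ * R ε) ≤ η * R ε * threshold ϰ ε (x ε) :=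
    mul_le_mul_of_nonneg_left ht.le (by positivity)
  have hnormA : 4 * (η * R ε) ^ 2 * normA ϰ ε ≤ η * δ / 2 * R ε ^ 2 :=
    (mul_le_mul_of_nonneg_left (hA ε hε).2.le (by positivity)).trans_eq
      (by linear_combination 4 * η * R ε ^ 2 * hηC)
  have hpos : 0 < η * δ * R ε ^ 2 := by positivity
  linarith

lemma isLDConsistent_of_isBigO_energy (hW : IsWhiteNoise P W) (hφ : Orthonormal ℝ φ)
    (hϰ : Conditions ϰ) (hR : Tendsto R (𝓝[>] 0) atTop)
    (hRw : Tendsto (fun ε => R ε * weight ϰ ε 1) (𝓝[>] 0) (𝓝 0))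
    (h : R =O[𝓝[>] 0] fun ε => energy φ ϰ ε (S ε)) : IsLDConsistent P W φ ϰ R S := by
  intro x hpos hlog
  obtain ⟨_, _, C, hC, hA⟩ := hϰ.A2
  obtain ⟨K, hK, h⟩ := h.exists_pos
  obtain ⟨c, hc, hcK⟩ : ∃ c > 0, c * K = 1 := ⟨K⁻¹, by positivity, by field_simp⟩
  obtain ⟨η, hη, hηC⟩ : ∃ η > 0, η * C = c / 32 := ⟨c / 32 / C, by positivity, by field_simp⟩
  refine ⟨η * c / 4, by positivity, ?_⟩
  filter_upwards [h.bound, hR.eventually_gt_atTop 0, self_mem_nhdsWithin,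
    eventually_threshold_le hW hφ hϰ hR hRw hpos hlog (δ := c / 8) (by positivity),
    eventually_mul_weight_one_le hRw η (c := 1 / 8) (by norm_num)]
    with ε henergy hRpos (hε : 0 < ε) hthreshold hw
  refine eq_zero_or_le_abs_log_of_le_exp_neg measureReal_nonneg
    ((typeII_le_exp hW hφ hϰ hε (by positivity) hw _ _).trans (Real.exp_le_exp.2 ?_))
  rw [Real.norm_of_nonneg hRpos.le, Real.norm_of_nonneg (energy_nonneg _ _ _ _)] at henergy
  have henergy : η * R ε / 2 * (c * R ε) ≤ η * R ε / 2 * energy φ ϰ ε (S ε) := by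
    refine mul_le_mul_of_nonneg_left ?_ (by positivity)
    calc c * R ε ≤ c * (K * energy φ ϰ ε (S ε)) := mul_le_mul_of_nonneg_left henergy hc.le
      _ = energy φ ϰ ε (S ε) := by rw [← mul_assoc, hcK, one_mul]
  have hthreshold : η * R ε * threshold ϰ ε (x ε) ≤ η * R ε * (c / 8 * R ε) :=
    mul_le_mul_of_nonneg_left hthreshold (by positivity)
  have hnormA : 4 * (η * R ε) ^ 2 * normA ϰ ε ≤ η * c / 8 * R ε ^ 2 :=
    (mul_le_mul_of_nonneg_left (hA ε hε).2.le (by positivity)).trans_eq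
      (by linear_combination 4 * η * R ε ^ 2 * hηC)
  linarith

lemma exp_neg_add_two_le_exp_div_four (a : ℝ) :
    Real.exp (-(a + 2)) ≤ Real.exp (-a) / 4 := by
  have h : (4 : ℝ) ≤ Real.exp 2 := by
    calc (4 : ℝ) = 2 ^ 2 := by norm_num
      _ ≤ Real.exp 1 ^ 2 := by gcongr; linarith [Real.add_one_le_exp (1 : ℝ)]
      _ = Real.exp 2 := by rw [← Real.exp_nat_mul]; norm_num
  rw [neg_add, Real.exp_add, Real.exp_neg 2, ← div_eq_mul_inv]
  gcongr

lemma exp_neg_le_typeI_zero (hW : IsWhiteNoise P W) (hφ : Orthonormal ℝ φ) (hϰ : Conditions ϰ)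
    {ε κ : ℝ} (hε : 0 < ε) (hκ : 1 ≤ κ) (hκA : 2 ≤ κ * normA ϰ ε)
    (hw : κ * weight ϰ ε 1 ≤ 1 / 16) :
    Real.exp (-(15 * κ ^ 2 * normA ϰ ε + 2)) ≤ typeI P W φ ϰ ε 0 := by
  refine (exp_neg_add_two_le_exp_div_four _).trans
    (exp_div_four_le_typeI hW hφ hϰ hε (zero_le_one.trans hκ) hw ?_)
  rw [threshold_zero]
  nlinarith [Real.log_two_lt_d9]

lemma exp_neg_le_typeII_zero (hW : IsWhiteNoise P W) (hφ : Orthonormal ℝ φ) (hϰ : Conditions ϰ)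
    {ε κ : ℝ} (hε : 0 < ε) (hκ : 1 ≤ κ) (hκA : 2 ≤ κ * normA ϰ ε) {S : L2}
    (hw : κ * (1 + energy φ ϰ ε S) * weight ϰ ε 1 ≤ 1 / 16) :
    Real.exp (-((15 * κ ^ 2 * normA ϰ ε + κ + 2) * (1 + energy φ ϰ ε S) ^ 2)) ≤
      typeII P W φ ϰ ε 0 S := by
  have he : 0 ≤ energy φ ϰ ε S := energy_nonneg φ ϰ ε S
  set e := energy φ ϰ ε S
  -- Tilting by the order `κ (1 + e)` lowers the mean of the sum enough to offset the signal.
  have hκe : 0 ≤ κ * e := by positivity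
  have hs : κ * (1 + e) * e + Real.log 2 ≤ κ * (1 + e) ^ 2 := by
    linarith [Real.log_two_lt_d9]
  have hsA : κ * (1 + e) ^ 2 ≤ (κ * (1 + e)) ^ 2 / 2 * normA ϰ ε := by
    calc κ * (1 + e) ^ 2 = κ * (1 + e) ^ 2 / 2 * 2 := by ring
      _ ≤ κ * (1 + e) ^ 2 / 2 * (κ * normA ϰ ε) := mul_le_mul_of_nonneg_left hκA (by positivity)
      _ = (κ * (1 + e)) ^ 2 / 2 * normA ϰ ε := by ring
  have hexponent : 15 * (κ * (1 + e)) ^ 2 * normA ϰ ε + κ * (1 + e) * e + 2 ≤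
      (15 * κ ^ 2 * normA ϰ ε + κ + 2) * (1 + e) ^ 2 := by
    nlinarith
  calc Real.exp (-((15 * κ ^ 2 * normA ϰ ε + κ + 2) * (1 + e) ^ 2))
      ≤ Real.exp (-(15 * (κ * (1 + e)) ^ 2 * normA ϰ ε + κ * (1 + e) * e + 2)) :=
        Real.exp_le_exp.2 (neg_le_neg hexponent)
    _ ≤ Real.exp (-(15 * (κ * (1 + e)) ^ 2 * normA ϰ ε + κ * (1 + e) * e)) / 4 :=
        exp_neg_add_two_le_exp_div_four _
    _ = Real.exp (-(15 * (κ * (1 + e)) ^ 2 * normA ϰ ε) - κ * (1 + e) * e) / 4 := by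
        rw [neg_add, ← sub_eq_add_neg]
    _ ≤ typeII P W φ ϰ ε 0 S := by
        refine exp_div_four_le_typeII hW hφ hϰ hε (by positivity) hw ?_
        rw [threshold_zero, mul_zero, add_zero]
        exact hs.trans hsA

lemma Conditions.exists_two_le_mul_normA (hϰ : Conditions ϰ) :
    ∃ κ : ℝ, 1 ≤ κ ∧ ∀ ε > 0, 2 ≤ κ * normA ϰ ε := by
  obtain ⟨C, hC, _, _, hA⟩ := hϰ.A2
  refine ⟨max 1 (2 / C), le_max_left _ _, fun ε hε => ?_⟩
  calc 2 = 2 / C * C := by field_simp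
    _ ≤ max 1 (2 / C) * normA ϰ ε := by
        gcongr
        exacts [le_max_right _ _, (hA ε hε).1.le]

lemma eventually_exp_neg_le_typeI_zero (hW : IsWhiteNoise P W) (hφ : Orthonormal ℝ φ)
    (hϰ : Conditions ϰ) (hw : Tendsto (fun ε => weight ϰ ε 1) (𝓝[>] 0) (𝓝 0)) :
    ∃ D : ℝ, ∀ᶠ ε in 𝓝[>] 0, Real.exp (-D) ≤ typeI P W φ ϰ ε 0 := by
  obtain ⟨κ, hκ, hκA⟩ := hϰ.exists_two_le_mul_normA
  obtain ⟨_, _, C, _, hA⟩ := hϰ.A2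
  have hκw := hw.const_mul κ
  rw [mul_zero] at hκw
  refine ⟨15 * κ ^ 2 * C + 2, ?_⟩
  filter_upwards [hκw.eventually_le_const (u := 1 / 16) (by norm_num), self_mem_nhdsWithin]
    with ε hw (hε : 0 < ε)
  refine (Real.exp_le_exp.2 (neg_le_neg ?_)).trans
    (exp_neg_le_typeI_zero hW hφ hϰ hε hκ (hκA ε hε) hw)
  gcongr
  exact (hA ε hε).2.le

lemma tendsto_inv_sq_mul_log_of_exp_neg_le {p : ℝ → ℝ} {l : Filter ℝ} {D : ℝ}
    (hR : Tendsto R l atTop) (hp : ∀ᶠ ε in l, Real.exp (-D) ≤ p ε) (hp1 : ∀ ε, p ε ≤ 1) :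
    Tendsto (fun ε => (R ε ^ 2)⁻¹ * Real.log (p ε)) l (𝓝 0) := by
  have hinv : Tendsto (fun ε => (R ε ^ 2)⁻¹ * -D) l (𝓝 0) := by
    rw [← zero_mul (-D)]
    exact (tendsto_inv_atTop_zero.comp ((tendsto_pow_atTop two_ne_zero).comp hR)).mul_const (-D)
  refine tendsto_of_tendsto_of_tendsto_of_le_of_le' hinv tendsto_const_nhds ?_ ?_
  · filter_upwards [hp] with ε hp
    exact mul_le_mul_of_nonneg_left ((Real.le_log_iff_exp_le ((Real.exp_pos _).trans_le hp)).2 hp)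
      (by positivity)
  · filter_upwards [hp] with ε hp
    exact mul_nonpos_of_nonneg_of_nonpos (by positivity)
      (Real.log_nonpos ((Real.exp_pos _).le.trans hp) (hp1 ε))

lemma isBigO_of_le_mul_one_add {α : Type*} {l : Filter α} {f g : α → ℝ} {M : ℝ} (hg : ∀ a, 0 ≤ g a)
    (hf : Tendsto f l atTop) (h : ∀ᶠ a in l, f a ≤ M * (1 + g a)) : f =O[l] g := by
  refine IsBigO.of_bound (2 * M) ?_
  filter_upwards [h, hf.eventually_ge_atTop (2 * M), hf.eventually_ge_atTop 0] with a h hM hf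
  rw [Real.norm_of_nonneg hf, Real.norm_of_nonneg (hg a)]
  linarith

lemma le_sqrt_mul_of_exp_neg_le {β c D R u : ℝ} (hc : 0 < c) (hu : 0 ≤ u)
    (hβ : Real.exp (-(D * u ^ 2)) ≤ β) (hβ1 : β ≤ 1) (h : β = 0 ∨ c * R ^ 2 ≤ |Real.log β|) :
    R ≤ √(D / c) * u := by
  have hβpos : 0 < β := (Real.exp_pos _).trans_le hβ
  have hsq : R ^ 2 ≤ D / c * u ^ 2 := by
    rw [div_mul_eq_mul_div, le_div_iff₀' hc]
    refine (h.resolve_left hβpos.ne').trans ?_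
    rw [abs_of_nonpos (Real.log_nonpos hβpos.le hβ1), neg_le]
    exact (Real.le_log_iff_exp_le hβpos).2 hβ
  calc R ≤ √(D / c * u ^ 2) := Real.le_sqrt_of_sq_le hsq
    _ = √(D / c) * u := by rw [Real.sqrt_mul' _ (sq_nonneg u), Real.sqrt_sq hu]

lemma isBigO_energy_of_isLDConsistent (hW : IsWhiteNoise P W) (hφ : Orthonormal ℝ φ)
    (hϰ : Conditions ϰ) (hR : Tendsto R (𝓝[>] 0) atTop)
    (hRw : Tendsto (fun ε => R ε * weight ϰ ε 1) (𝓝[>] 0) (𝓝 0))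
    (h : IsLDConsistent P W φ ϰ R S) : R =O[𝓝[>] 0] fun ε => energy φ ϰ ε (S ε) := by
  have hw : Tendsto (fun ε => weight ϰ ε 1) (𝓝[>] 0) (𝓝 0) := by
    refine squeeze_zero' (.of_forall fun ε => weight_nonneg ϰ ε 1) ?_ hRw
    filter_upwards [hR.eventually_ge_atTop 1] with ε hε
    exact le_mul_of_one_le_left (weight_nonneg ϰ ε 1) hε
  obtain ⟨_, hα⟩ := eventually_exp_neg_le_typeI_zero hW hφ hϰ hw
  obtain ⟨c, hc, hβ⟩ := h (fun _ => 0) (hα.mono fun ε h => (Real.exp_pos _).trans_le h)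
    (tendsto_inv_sq_mul_log_of_exp_neg_le hR hα fun ε => measureReal_le_one)
  obtain ⟨κ, hκ, hκA⟩ := hϰ.exists_two_le_mul_normA
  obtain ⟨_, _, C, _, hA⟩ := hϰ.A2
  set D := 15 * κ ^ 2 * C + κ + 2
  refine isBigO_of_le_mul_one_add (M := max 1 √(D / c)) (fun ε => energy_nonneg _ _ _ _) hR ?_
  filter_upwards [hβ, eventually_mul_weight_one_le hRw κ (c := 1 / 16) (by norm_num),
    self_mem_nhdsWithin] with ε hβ hw (hε : 0 < ε)
  have he := energy_nonneg φ ϰ ε (S ε)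
  set e := energy φ ϰ ε (S ε)
  set β := typeII P W φ ϰ ε 0 (S ε)
  rcases le_total (R ε) (1 + e) with hRe | heR
  · exact hRe.trans (le_mul_of_one_le_left (by positivity) (le_max_left _ _))
  have hβexp : Real.exp (-(D * (1 + e) ^ 2)) ≤ β := by
    refine (Real.exp_le_exp.2 (neg_le_neg ?_)).trans
      (exp_neg_le_typeII_zero hW hφ hϰ hε hκ (hκA ε hε) (hw.trans' ?_))
    · simp only [D]
      gcongr
      exact (hA ε hε).2.le
    · gcongr
      exact weight_nonneg ϰ ε 1
  refine (le_sqrt_mul_of_exp_neg_le hc (by positivity) hβexp measureReal_le_one hβ).trans ?_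
  exact mul_le_mul_of_nonneg_right (le_max_right _ _) (by positivity)

theorem isLDConsistent_iff_isBigO_energy (hW : IsWhiteNoise P W) (hφ : Orthonormal ℝ φ)
    (hϰ : Conditions ϰ) (hR : Tendsto R (𝓝[>] 0) atTop)
    (hRw : Tendsto (fun ε => R ε * weight ϰ ε 1) (𝓝[>] 0) (𝓝 0)) :
    IsLDConsistent P W φ ϰ R S ↔ R =O[𝓝[>] 0] fun ε => energy φ ϰ ε (S ε) :=
  ⟨isBigO_energy_of_isLDConsistent hW hφ hϰ hR hRw, isLDConsistent_of_isBigO_energy hW hφ hϰ hR hRw⟩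

end LDConsistency

section Cutoff

variable {ϰ : ℝ → ℕ+ → ℝ} {ε : ℝ}

/-- The weight `ϰ_ε² / ε²` at the cut-off frequency `k_ε`, the typical size of the large weights. -/
def cutoffWeight (ϰ : ℝ → ℕ+ → ℝ) (ε : ℝ) : ℝ := kappaSq ϰ ε / ε ^ 2

lemma cutoffWeight_nonneg (ϰ : ℝ → ℕ+ → ℝ) (ε : ℝ) : 0 ≤ cutoffWeight ϰ ε :=
  weight_nonneg ϰ ε _

lemma sum_le_sum_Ico_toPNat' {f : ℕ+ → ℝ} (hf : ∀ j, 0 ≤ f j) {s : Finset ℕ+} {k : ℕ}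
    (hs : ∀ j ∈ s, (j : ℕ) < k) : ∑ j ∈ s, f j ≤ ∑ j ∈ Finset.Ico 1 k, f j.toPNat' := by
  rw [← Finset.sum_image (f := f) (s := Finset.Ico 1 k) (g := Nat.toPNat') ?_]
  · refine Finset.sum_le_sum_of_subset_of_nonneg (fun j hj => ?_) fun j _ _ => hf j
    exact Finset.mem_image.2 ⟨j, Finset.mem_Ico.2 ⟨j.pos, hs j hj⟩, PNat.coe_toPNat' j⟩
  · intro i hi j hj hij
    rw [Finset.coe_Ico, Set.mem_Ico] at hi hj
    simpa only [Nat.toPNat'_coe, if_pos (Nat.lt_of_succ_le hi.1),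
      if_pos (Nat.lt_of_succ_le hj.1)] using congrArg PNat.val hij

namespace Conditions

lemma rhoSq_pos (hϰ : Conditions ϰ) (hε : 0 < ε) : 0 < rhoSq ϰ ε := by
  refine (tsum_nonneg fun j => sq_nonneg (ϰ ε j)).lt_of_ne' fun h => ?_
  have hzero := (hasSum_zero_iff_of_nonneg fun j => sq_nonneg (ϰ ε j)).1
    (h ▸ (hϰ.summable ε hε).hasSum)
  have hϰzero : ∀ j, ϰ ε j = 0 := fun j => sq_eq_zero_iff.1 (congrFun hzero j)
  exact (hϰ.normA_pos hε).ne' (by simp [normA, hϰzero])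

lemma one_le_cutoff (hϰ : Conditions ϰ) (hε : 0 < ε) : 1 ≤ cutoff ϰ ε := by
  have hρ := hϰ.rhoSq_pos hε
  refine le_csSup ?_ ⟨le_rfl, by simpa using (half_pos hρ).le⟩
  by_contra hbdd
  have hle : rhoSq ϰ ε ≤ rhoSq ϰ ε / 2 := by
    refine Real.tsum_le_of_sum_le (fun j => sq_nonneg _) fun s => ?_
    obtain ⟨k, hk, hsk⟩ := not_bddAbove_iff.1 hbdd (s.sup PNat.val)
    exact (sum_le_sum_Ico_toPNat' (fun j => sq_nonneg _)
      fun j hj => (Finset.le_sup (f := PNat.val) hj).trans_lt hsk).trans hk.2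
  linarith

lemma exists_le_weight_of_lt_mul_cutoff (hϰ : Conditions ϰ) (c : ℝ) :
    ∃ C > 0, ∀ ε > 0, ∀ j : ℕ+, j < c * cutoff ϰ ε → C * cutoffWeight ϰ ε ≤ weight ϰ ε j := by
  obtain ⟨C, hC, h⟩ := hϰ.A4_tail (max c 2) (lt_max_of_lt_right (by norm_num))
  refine ⟨C, hC, fun ε hε j hj => ?_⟩
  have hjfloor : (j : ℕ) ≤ ⌊max c 2 * (cutoff ϰ ε : ℝ)⌋₊ :=
    Nat.le_floor (hj.le.trans (mul_le_mul_of_nonneg_right (le_max_left _ _) (Nat.cast_nonneg _)))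
  have hj : j ≤ (⌊max c 2 * (cutoff ϰ ε : ℝ)⌋₊).toPNat' := by
    rwa [← PNat.coe_le_coe, Nat.toPNat'_coe, if_pos (j.pos.trans_le hjfloor)]
  rw [cutoffWeight, ← mul_div_assoc]
  exact div_le_div_of_nonneg_right ((h ε hε).trans (hϰ.A1 ε hε hj)) (sq_nonneg ε)

lemma exists_weight_le_of_cutoff_lt (hϰ : Conditions ϰ) :
    ∃ C > 0, ∀ ε > 0, ∀ j : ℕ+, cutoff ϰ ε < (j : ℕ) →
      weight ϰ ε j ≤ C * (cutoff ϰ ε / j) * cutoffWeight ϰ ε := by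
  obtain ⟨C, hC, lam, hlam, h⟩ := hϰ.A3
  refine ⟨C, hC, fun ε hε j hj => ?_⟩
  have hk : (0 : ℝ) < cutoff ϰ ε := Nat.cast_pos.2 (hϰ.one_le_cutoff hε)
  have hjk : 1 < (j : ℝ) / cutoff ϰ ε := (one_lt_div hk).2 (Nat.cast_lt.2 hj)
  have hdecay : ϰ ε j ^ 2 < C * ((j : ℝ) / cutoff ϰ ε) ^ (-lam) * kappaSq ϰ ε := by
    simpa only [add_sub_cancel, div_mul_cancel₀ _ hk.ne', Nat.floor_natCast, PNat.coe_toPNat']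
      using h (j / cutoff ϰ ε - 1) (sub_pos.2 hjk) ε hε
  have hpow : ((j : ℝ) / cutoff ϰ ε) ^ (-lam) ≤ cutoff ϰ ε / j :=
    calc ((j : ℝ) / cutoff ϰ ε) ^ (-lam) ≤ ((j : ℝ) / cutoff ϰ ε) ^ (-1 : ℝ) :=
          Real.rpow_le_rpow_of_exponent_le hjk.le (by linarith)
      _ = cutoff ϰ ε / j := by rw [Real.rpow_neg_one, inv_div]
  rw [weight, cutoffWeight, ← mul_div_assoc]
  refine div_le_div_of_nonneg_right (hdecay.le.trans ?_) (sq_nonneg ε)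
  exact mul_le_mul_of_nonneg_right (mul_le_mul_of_nonneg_left hpow hC.le) (sq_nonneg _)

lemma weight_one_isBigO (hϰ : Conditions ϰ) :
    (fun ε => weight ϰ ε 1) =O[𝓝[>] 0] cutoffWeight ϰ := by
  refine (hϰ.A4_first.1.mul (isBigO_refl (fun ε : ℝ => (ε ^ 2)⁻¹) (𝓝[>] 0))).congr
    (fun ε => ?_) fun ε => ?_
  · rw [weight, div_eq_mul_inv]
  · rw [cutoffWeight, div_eq_mul_inv]

lemma cutoff_mul_cutoffWeight_sq_le_normA (hϰ : Conditions ϰ) (hε : 0 < ε) :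
    cutoff ϰ ε * cutoffWeight ϰ ε ^ 2 ≤ normA ϰ ε := by
  set k := (cutoff ϰ ε).toPNat' with hk
  have hkk : (k : ℕ) = cutoff ϰ ε := by
    rw [hk, Nat.toPNat'_coe, if_pos (Nat.lt_of_succ_le (hϰ.one_le_cutoff hε))]
  calc cutoff ϰ ε * cutoffWeight ϰ ε ^ 2 = ∑ _j ∈ Finset.Icc 1 k, cutoffWeight ϰ ε ^ 2 := by
        rw [Finset.sum_const, PNat.card_Icc, PNat.one_coe, Nat.add_sub_cancel, hkk, nsmul_eq_mul]
    _ ≤ ∑ j ∈ Finset.Icc 1 k, weight ϰ ε j ^ 2 :=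
        Finset.sum_le_sum fun j hj => pow_le_pow_left₀ (cutoffWeight_nonneg ϰ ε)
          (hϰ.weight_antitone hε (Finset.mem_Icc.1 hj).2) 2
    _ ≤ ∑' j, weight ϰ ε j ^ 2 :=
        (summable_sq_of_nonneg_of_summable (weight_nonneg ϰ ε)
          (hϰ.summable_weight hε)).sum_le_tsum _ fun _ _ => sq_nonneg _
    _ = normA ϰ ε := tsum_weight_sq ϰ ε

end Conditions

lemma tsum_sq_le_of_le_mul_div_add {f : ℕ+ → ℝ} {k D : ℝ} (hk : 0 < k) (hf : ∀ j, 0 ≤ f j)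
    (h : ∀ j : ℕ+, f j ≤ D * (k / (k + j))) : ∑' j, f j ^ 2 ≤ D ^ 2 * k := by
  rw [← Equiv.pnatEquivNat.symm.tsum_eq]
  refine Real.tsum_le_of_sum_range_le (fun i => sq_nonneg _) fun n => ?_
  calc ∑ i ∈ Finset.range n, f i.succPNat ^ 2
      ≤ ∑ i ∈ Finset.range n, D ^ 2 * k ^ 2 * (1 / (k + i) - 1 / (k + (i + 1 : ℕ))) := by
        refine Finset.sum_le_sum fun i _ => ?_
        calc f i.succPNat ^ 2 ≤ (D * (k / (k + (i + 1 : ℕ)))) ^ 2 :=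
              pow_le_pow_left₀ (hf _) (h i.succPNat) 2
          _ = D ^ 2 * k ^ 2 * (1 / ((k + (i + 1 : ℕ)) * (k + (i + 1 : ℕ)))) := by
              field_simp
          _ ≤ D ^ 2 * k ^ 2 * (1 / ((k + i) * (k + (i + 1 : ℕ)))) := by
              gcongr
              exact i.le_succ
          _ = D ^ 2 * k ^ 2 * (1 / (k + i) - 1 / (k + (i + 1 : ℕ))) := by
              push_cast
              field_simp
              ring
    _ = D ^ 2 * k ^ 2 * (1 / k - 1 / (k + n)) := by
        rw [← Finset.mul_sum, Finset.sum_range_sub' fun i : ℕ => 1 / (k + i), Nat.cast_zero,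
          add_zero]
    _ ≤ D ^ 2 * k ^ 2 * (1 / k) := by
        gcongr
        exact sub_le_self _ (by positivity)
    _ = D ^ 2 * k := by field_simp

namespace Conditions

lemma exists_eventually_weight_le (hϰ : Conditions ϰ) :
    ∃ C > 0, ∀ᶠ ε in 𝓝[>] 0, ∀ j,
      weight ϰ ε j ≤ C * cutoffWeight ϰ ε * (cutoff ϰ ε / (cutoff ϰ ε + j)) := by
  obtain ⟨C₁, hC₁, hone⟩ := hϰ.weight_one_isBigO.exists_pos
  obtain ⟨C₂, _, htail⟩ := hϰ.exists_weight_le_of_cutoff_lt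
  refine ⟨2 * max C₁ C₂, by positivity, ?_⟩
  filter_upwards [hone.bound, self_mem_nhdsWithin] with ε hone (hε : 0 < ε) j
  have hk : (0 : ℝ) < cutoff ϰ ε := Nat.cast_pos.2 (hϰ.one_le_cutoff hε)
  have hv := cutoffWeight_nonneg ϰ ε
  rw [Real.norm_of_nonneg (weight_nonneg ϰ ε 1), Real.norm_of_nonneg hv] at hone
  rcases le_or_gt (j : ℕ) (cutoff ϰ ε) with hj | hj
  · have hhalf : (1 : ℝ) ≤ 2 * (cutoff ϰ ε / (cutoff ϰ ε + j)) := by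
      have : (j : ℝ) ≤ cutoff ϰ ε := Nat.cast_le.2 hj
      rw [← mul_div_assoc, one_le_div (by positivity)]
      linarith
    calc weight ϰ ε j ≤ C₁ * cutoffWeight ϰ ε := (hϰ.weight_le_weight_one hε j).trans hone
      _ ≤ max C₁ C₂ * cutoffWeight ϰ ε := by gcongr; exact le_max_left _ _
      _ ≤ max C₁ C₂ * cutoffWeight ϰ ε * (2 * (cutoff ϰ ε / (cutoff ϰ ε + j))) :=
          le_mul_of_one_le_right (by positivity) hhalf
      _ = _ := by ring
  · have hratio : (cutoff ϰ ε / j : ℝ) ≤ 2 * (cutoff ϰ ε / (cutoff ϰ ε + j)) := by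
      have : (cutoff ϰ ε : ℝ) < j := Nat.cast_lt.2 hj
      rw [← mul_div_assoc, div_le_div_iff₀ (by positivity) (by positivity)]
      nlinarith
    calc weight ϰ ε j ≤ C₂ * (cutoff ϰ ε / j) * cutoffWeight ϰ ε := htail ε hε j hj
      _ ≤ max C₁ C₂ * (2 * (cutoff ϰ ε / (cutoff ϰ ε + j))) * cutoffWeight ϰ ε := by
          gcongr
          exact le_max_right _ _
      _ = _ := by ring

lemma cutoffWeight_isBigO (hϰ : Conditions ϰ) :
    cutoffWeight ϰ =O[𝓝[>] 0] fun ε => (√(cutoff ϰ ε : ℝ))⁻¹ := by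
  obtain ⟨_, _, C, hC, hA⟩ := hϰ.A2
  refine IsBigO.of_bound √C ?_
  filter_upwards [self_mem_nhdsWithin] with ε (hε : 0 < ε)
  have hk : (0 : ℝ) < cutoff ϰ ε := Nat.cast_pos.2 (hϰ.one_le_cutoff hε)
  rw [Real.norm_of_nonneg (cutoffWeight_nonneg ϰ ε), Real.norm_of_nonneg (by positivity),
    ← Real.sqrt_inv, ← Real.sqrt_mul hC.le]
  refine Real.le_sqrt_of_sq_le ?_
  rw [← div_eq_mul_inv, le_div_iff₀' hk]
  exact (hϰ.cutoff_mul_cutoffWeight_sq_le_normA hε).trans (hA ε hε).2.le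

lemma isBigO_cutoffWeight (hϰ : Conditions ϰ) :
    (fun ε => (√(cutoff ϰ ε : ℝ))⁻¹) =O[𝓝[>] 0] cutoffWeight ϰ := by
  obtain ⟨C, hC, _, _, hA⟩ := hϰ.A2
  obtain ⟨D, hD, hweight⟩ := hϰ.exists_eventually_weight_le
  refine IsBigO.of_bound (D / √C) ?_
  filter_upwards [hweight, self_mem_nhdsWithin] with ε hweight (hε : 0 < ε)
  have hk : (0 : ℝ) < cutoff ϰ ε := Nat.cast_pos.2 (hϰ.one_le_cutoff hε)
  have hv := cutoffWeight_nonneg ϰ ε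
  have hnormA : C ≤ (D * cutoffWeight ϰ ε) ^ 2 * cutoff ϰ ε :=
    (hA ε hε).1.le.trans ((tsum_weight_sq ϰ ε).symm.trans_le
      (tsum_sq_le_of_le_mul_div_add hk (weight_nonneg ϰ ε) hweight))
  rw [Real.norm_of_nonneg hv, Real.norm_of_nonneg (by positivity), div_mul_eq_mul_div,
    inv_le_iff_one_le_mul₀ (by positivity), div_mul_eq_mul_div, one_le_div (by positivity)]
  refine Real.sqrt_le_iff.2 ⟨by positivity, ?_⟩
  rwa [mul_pow, Real.sq_sqrt hk.le]

lemma cutoffWeight_isTheta (hϰ : Conditions ϰ) :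
    cutoffWeight ϰ =Θ[𝓝[>] 0] fun ε => (√(cutoff ϰ ε : ℝ))⁻¹ :=
  ⟨hϰ.cutoffWeight_isBigO, hϰ.isBigO_cutoffWeight⟩

end Conditions

end Cutoff

section LowFrequencies

variable {φ : ℕ+ → L2} {ϰ : ℝ → ℕ+ → ℝ} {ε : ℝ}

/-- The energy `∑_{j < K} |θ_j|²` of a signal at the frequencies below `K`. -/
def lowFreqEnergy (φ : ℕ+ → L2) (S : L2) (K : ℝ) : ℝ :=
  ∑' j : ℕ+, if (j : ℝ) < K then |fourierCoeff φ S j| ^ 2 else 0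

lemma summable_lowFreqEnergy (hφ : Orthonormal ℝ φ) (S : L2) (K : ℝ) :
    Summable fun j : ℕ+ => if (j : ℝ) < K then |fourierCoeff φ S j| ^ 2 else 0 := by
  simp only [sq_abs]
  exact (summable_fourierCoeff_sq hφ S).indicator {j : ℕ+ | (j : ℝ) < K}

lemma Conditions.mul_lowFreqEnergy_le_energy (hϰ : Conditions ϰ) (hφ : Orthonormal ℝ φ)
    (hε : 0 < ε) (S : L2) {K v : ℝ} (hv : ∀ j : ℕ+, (j : ℝ) < K → v ≤ weight ϰ ε j) :
    v / ε ^ 2 * lowFreqEnergy φ S K ≤ energy φ ϰ ε S := by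
  rw [lowFreqEnergy, energy, ← tsum_mul_left]
  refine Summable.tsum_le_tsum (fun j => ?_) ((summable_lowFreqEnergy hφ S K).mul_left _)
    (hϰ.summable_weight_mul_normMean_sq hφ hε S)
  split_ifs with hj
  · rw [sq_abs, normMean, div_pow, div_mul_eq_mul_div, mul_div_assoc]
    exact mul_le_mul_of_nonneg_right (hv j hj) (by positivity)
  · rw [mul_zero]
    exact mul_nonneg (weight_nonneg ϰ ε j) (sq_nonneg _)

lemma Conditions.energy_le (hϰ : Conditions ϰ) (hφ : Orthonormal ℝ φ) (hε : 0 < ε) (S : L2)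
    {K v u : ℝ} (hu : 0 ≤ u) (hv : ∀ j, weight ϰ ε j ≤ v)
    (huK : ∀ j : ℕ+, K ≤ j → weight ϰ ε j ≤ u) :
    energy φ ϰ ε S ≤ v / ε ^ 2 * lowFreqEnergy φ S K + u / ε ^ 2 * ‖S‖ ^ 2 := by
  have hlow := (summable_lowFreqEnergy hφ S K).mul_left (v / ε ^ 2)
  have hall := (summable_fourierCoeff_sq hφ S).mul_left (u / ε ^ 2)
  calc energy φ ϰ ε S
      ≤ v / ε ^ 2 * lowFreqEnergy φ S K + u / ε ^ 2 * ∑' j, fourierCoeff φ S j ^ 2 := by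
        rw [energy, lowFreqEnergy, ← tsum_mul_left, ← tsum_mul_left, ← hlow.tsum_add hall]
        refine Summable.tsum_le_tsum (fun j => ?_) (hϰ.summable_weight_mul_normMean_sq hφ hε S)
          (hlow.add hall)
        rw [normMean, div_pow, mul_div_left_comm, mul_comm]
        split_ifs with hj
        · rw [sq_abs]
          refine le_add_of_le_of_nonneg ?_ (by positivity)
          gcongr
          exact hv j
        · rw [mul_zero, zero_add]
          gcongr
          exact huK j (not_lt.1 hj)
    _ ≤ v / ε ^ 2 * lowFreqEnergy φ S K + u / ε ^ 2 * ‖S‖ ^ 2 := by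
        gcongr
        exact tsum_fourierCoeff_sq_le hφ S

lemma Conditions.exists_lowFreqEnergy_le_energy (hϰ : Conditions ϰ) (hφ : Orthonormal ℝ φ)
    (c : ℝ) : ∃ C > 0, ∀ ε > 0, ∀ S,
      C * (cutoffWeight ϰ ε / ε ^ 2) * lowFreqEnergy φ S (c * cutoff ϰ ε) ≤ energy φ ϰ ε S := by
  obtain ⟨C, hC, hweight⟩ := hϰ.exists_le_weight_of_lt_mul_cutoff c
  refine ⟨C, hC, fun ε hε S => ?_⟩
  rw [← mul_div_assoc]
  exact hϰ.mul_lowFreqEnergy_le_energy hφ hε S (hweight ε hε)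

lemma Conditions.exists_eventually_energy_le (hϰ : Conditions ϰ) (hφ : Orthonormal ℝ φ) :
    ∃ C > 0, ∀ᶠ ε in 𝓝[>] 0, ∀ S, ∀ c > 0, energy φ ϰ ε S ≤
      C * (cutoffWeight ϰ ε / ε ^ 2) * (lowFreqEnergy φ S (c * cutoff ϰ ε) + c⁻¹ * ‖S‖ ^ 2) := by
  obtain ⟨C, hC, hweight⟩ := hϰ.exists_eventually_weight_le
  refine ⟨C, hC, ?_⟩
  filter_upwards [hweight, self_mem_nhdsWithin] with ε hweight (hε : 0 < ε) S c hc
  have hk : (0 : ℝ) < cutoff ϰ ε := Nat.cast_pos.2 (hϰ.one_le_cutoff hε)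
  have hv : 0 ≤ C * cutoffWeight ϰ ε := mul_nonneg hC.le (cutoffWeight_nonneg ϰ ε)
  refine (hϰ.energy_le hφ hε S (K := c * cutoff ϰ ε) (v := C * cutoffWeight ϰ ε)
    (u := C * cutoffWeight ϰ ε * c⁻¹) (by positivity) (fun j => (hweight j).trans ?_)
    fun j hj => (hweight j).trans ?_).trans_eq (by ring)
  · refine mul_le_of_le_one_right hv ((div_le_one (by positivity)).2 ?_)
    exact le_add_of_nonneg_right (Nat.cast_nonneg _)
  · refine mul_le_mul_of_nonneg_left ?_ hv
    rw [div_le_iff₀ (by positivity), le_inv_mul_iff₀ hc]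
    exact hj.trans (le_add_of_nonneg_left hk.le)

lemma Conditions.eventually_cutoffWeight_pos (hϰ : Conditions ϰ) :
    ∀ᶠ ε in 𝓝[>] 0, 0 < cutoffWeight ϰ ε := by
  filter_upwards [hϰ.cutoffWeight_isTheta.eq_zero_iff, self_mem_nhdsWithin]
    with ε hzero (hε : 0 < ε)
  have hk : (0 : ℝ) < cutoff ϰ ε := Nat.cast_pos.2 (hϰ.one_le_cutoff hε)
  exact (cutoffWeight_nonneg ϰ ε).lt_of_ne' (hzero.not.2 (by positivity))

variable {S : ℝ → L2} {τ : ℝ → ℝ}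

lemma exists_lt_lowFreqEnergy_of_isBigO_energy (hφ : Orthonormal ℝ φ) (hϰ : Conditions ϰ)
    (hτ : ∀ᶠ ε in 𝓝[>] 0, 0 < τ ε) (hS : (fun ε => ‖S ε‖ ^ 2) =O[𝓝[>] 0] τ)
    (h : (fun ε => cutoffWeight ϰ ε / ε ^ 2 * τ ε) =O[𝓝[>] 0] fun ε => energy φ ϰ ε (S ε)) :
    ∃ c₁ > (0 : ℝ), ∃ c₂ > (0 : ℝ), ∀ᶠ ε in 𝓝[>] 0,
      c₁ * τ ε < lowFreqEnergy φ (S ε) (c₂ * cutoff ϰ ε) := by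
  obtain ⟨D, hD, h⟩ := h.exists_pos
  obtain ⟨M, hM, hS⟩ := hS.exists_pos
  obtain ⟨C, hC, henergy⟩ := hϰ.exists_eventually_energy_le hφ
  refine ⟨(4 * (D * C))⁻¹, by positivity, 2 * (D * C * M), by positivity, ?_⟩
  filter_upwards [h.bound, hS.bound, henergy, hτ, hϰ.eventually_cutoffWeight_pos,
    self_mem_nhdsWithin] with ε h hS henergy hτ hv (hε : 0 < ε)
  rw [Real.norm_of_nonneg (by positivity), Real.norm_of_nonneg (energy_nonneg _ _ _ _)] at h
  rw [Real.norm_of_nonneg (by positivity), Real.norm_of_nonneg hτ.le] at hS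
  have henergy := henergy (S ε) (2 * (D * C * M)) (by positivity)
  set L := lowFreqEnergy φ (S ε) (2 * (D * C * M) * cutoff ϰ ε)
  have hhalf : τ ε ≤ D * C * L + τ ε / 2 := by
    refine le_of_mul_le_mul_left ?_ (show 0 < cutoffWeight ϰ ε / ε ^ 2 by positivity)
    calc cutoffWeight ϰ ε / ε ^ 2 * τ ε
        ≤ D * (C * (cutoffWeight ϰ ε / ε ^ 2) *
            (L + (2 * (D * C * M))⁻¹ * (M * τ ε))) := by
          refine h.trans (mul_le_mul_of_nonneg_left (henergy.trans ?_) hD.le)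
          gcongr
      _ = cutoffWeight ϰ ε / ε ^ 2 * (D * C * L + τ ε / 2) := by field_simp
  rw [inv_mul_lt_iff₀ (by positivity)]
  linarith

lemma isBigO_energy_of_lt_lowFreqEnergy (hφ : Orthonormal ℝ φ) (hϰ : Conditions ϰ)
    (hτ : ∀ᶠ ε in 𝓝[>] 0, 0 < τ ε) {c₁ c₂ : ℝ} (hc₁ : 0 < c₁)
    (h : ∀ᶠ ε in 𝓝[>] 0, c₁ * τ ε < lowFreqEnergy φ (S ε) (c₂ * cutoff ϰ ε)) :
    (fun ε => cutoffWeight ϰ ε / ε ^ 2 * τ ε) =O[𝓝[>] 0] fun ε => energy φ ϰ ε (S ε) := by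
  obtain ⟨C, hC, henergy⟩ := hϰ.exists_lowFreqEnergy_le_energy hφ c₂
  refine IsBigO.of_bound (C * c₁)⁻¹ ?_
  filter_upwards [h, hτ, self_mem_nhdsWithin] with ε h hτ (hε : 0 < ε)
  have hv := cutoffWeight_nonneg ϰ ε
  rw [Real.norm_of_nonneg (by positivity), Real.norm_of_nonneg (energy_nonneg _ _ _ _),
    le_inv_mul_iff₀ (by positivity)]
  calc C * c₁ * (cutoffWeight ϰ ε / ε ^ 2 * τ ε)
      = C * (cutoffWeight ϰ ε / ε ^ 2) * (c₁ * τ ε) := by ring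
    _ ≤ C * (cutoffWeight ϰ ε / ε ^ 2) * lowFreqEnergy φ (S ε) (c₂ * cutoff ϰ ε) := by
        gcongr
    _ ≤ energy φ ϰ ε (S ε) := henergy ε hε (S ε)

theorem isBigO_energy_iff_exists_lt_lowFreqEnergy (hφ : Orthonormal ℝ φ) (hϰ : Conditions ϰ)
    (hτ : ∀ᶠ ε in 𝓝[>] 0, 0 < τ ε) (hS : (fun ε => ‖S ε‖ ^ 2) =O[𝓝[>] 0] τ) :
    ((fun ε => cutoffWeight ϰ ε / ε ^ 2 * τ ε) =O[𝓝[>] 0] fun ε => energy φ ϰ ε (S ε)) ↔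
      ∃ c₁ > (0 : ℝ), ∃ c₂ > (0 : ℝ), ∀ᶠ ε in 𝓝[>] 0,
        c₁ * τ ε < lowFreqEnergy φ (S ε) (c₂ * cutoff ϰ ε) :=
  ⟨exists_lt_lowFreqEnergy_of_isBigO_energy hφ hϰ hτ hS,
    fun ⟨_, hc₁, _, _, h⟩ => isBigO_energy_of_lt_lowFreqEnergy hφ hϰ hτ hc₁ h⟩

end LowFrequencies

section Rates

variable {ϰ : ℝ → ℕ+ → ℝ} {R τ : ℝ → ℝ}

lemma Conditions.tendsto_mul_weight_one (hϰ : Conditions ϰ)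
    (hRk : R =o[𝓝[>] 0] fun ε => √(cutoff ϰ ε : ℝ)) :
    Tendsto (fun ε => R ε * weight ϰ ε 1) (𝓝[>] 0) (𝓝 0) := by
  refine (isLittleO_one_iff ℝ).1
    ((hRk.mul_isBigO (hϰ.weight_one_isBigO.trans hϰ.cutoffWeight_isBigO)).congr' .rfl ?_)
  filter_upwards [self_mem_nhdsWithin] with ε (hε : 0 < ε)
  have hk : (0 : ℝ) < cutoff ϰ ε := Nat.cast_pos.2 (hϰ.one_le_cutoff hε)
  exact mul_inv_cancel₀ (Real.sqrt_pos.2 hk).ne'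

lemma Conditions.cutoffWeight_div_sq_mul_isTheta (hϰ : Conditions ϰ)
    (hτR : τ =Θ[𝓝[>] 0] fun ε => R ε * ε ^ 2 * √(cutoff ϰ ε : ℝ)) :
    (fun ε => cutoffWeight ϰ ε / ε ^ 2 * τ ε) =Θ[𝓝[>] 0] R := by
  refine ((hϰ.cutoffWeight_isTheta.div (isTheta_refl (fun ε : ℝ => ε ^ 2) _)).mul
    hτR).trans_eventuallyEq ?_
  filter_upwards [self_mem_nhdsWithin] with ε (hε : 0 < ε)
  have hk : (0 : ℝ) < cutoff ϰ ε := Nat.cast_pos.2 (hϰ.one_le_cutoff hε)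
  field_simp

end Rates

section PowerRates

variable {f : ℝ → ℝ} {a p q : ℝ}

lemma rpow_isLittleO_rpow_nhdsGT_zero (hap : a < p) :
    (fun ε : ℝ => ε ^ p) =o[𝓝[>] 0] fun ε : ℝ => ε ^ a := by
  have hne : ∀ᶠ ε : ℝ in 𝓝[>] 0, ε ^ a = 0 → ε ^ p = 0 := by
    filter_upwards [self_mem_nhdsWithin] with ε (hε : 0 < ε) h0
    exact absurd h0 (Real.rpow_pos_of_pos hε a).ne'
  refine (isLittleO_iff_tendsto' hne).2 ?_
  have hlim : Tendsto (fun ε : ℝ => ε ^ (p - a)) (𝓝[>] 0) (𝓝 (0 ^ (p - a))) :=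
    (Real.continuousAt_rpow_const 0 _ (.inr (sub_pos.2 hap).le)).tendsto.mono_left
      nhdsWithin_le_nhds
  rw [Real.zero_rpow (sub_pos.2 hap).ne'] at hlim
  refine hlim.congr' ?_
  filter_upwards [self_mem_nhdsWithin] with ε (hε : 0 < ε)
  exact Real.rpow_sub hε p a

lemma sqrt_isTheta_rpow_div_two (hf : ∀ ε, 0 ≤ f ε) (hfa : f =Θ[𝓝[>] 0] fun ε : ℝ => ε ^ a) :
    (fun ε => √(f ε)) =Θ[𝓝[>] 0] fun ε : ℝ => ε ^ (a / 2) := by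
  have hpow : ∀ᶠ ε : ℝ in 𝓝[>] 0, 0 ≤ ε ^ a :=
    eventually_nhdsWithin_of_forall fun ε (hε : 0 < ε) => Real.rpow_nonneg hε.le a
  refine (hfa.sqrt (.of_forall hf) hpow).trans_eventuallyEq ?_
  filter_upwards [self_mem_nhdsWithin] with ε (hε : 0 < ε)
  rw [Real.sqrt_eq_rpow, ← Real.rpow_mul hε.le, mul_one_div]

lemma rpow_isLittleO_sqrt (hf : ∀ ε, 0 ≤ f ε) (hfa : f =Θ[𝓝[>] 0] fun ε : ℝ => ε ^ a)
    (hap : a / 2 < p) : (fun ε : ℝ => ε ^ p) =o[𝓝[>] 0] fun ε => √(f ε) :=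
  (rpow_isLittleO_rpow_nhdsGT_zero hap).trans_isTheta (sqrt_isTheta_rpow_div_two hf hfa).symm

lemma rpow_isTheta_mul_sq_mul_sqrt (hf : ∀ ε, 0 ≤ f ε)
    (hfa : f =Θ[𝓝[>] 0] fun ε : ℝ => ε ^ a) (hpq : p + 2 + a / 2 = q) :
    (fun ε : ℝ => ε ^ q) =Θ[𝓝[>] 0] fun ε => ε ^ p * ε ^ 2 * √(f ε) := by
  refine IsTheta.symm (((isTheta_refl _ _).mul
    (sqrt_isTheta_rpow_div_two hf hfa)).trans_eventuallyEq ?_)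
  filter_upwards [self_mem_nhdsWithin] with ε (hε : 0 < ε)
  rw [← Real.rpow_two, ← Real.rpow_add hε, ← Real.rpow_add hε, hpq]

lemma sq_isBigO_rpow (hfp : f =O[𝓝[>] 0] fun ε : ℝ => ε ^ p) (hpq : p * 2 = q) :
    (fun ε => f ε ^ 2) =O[𝓝[>] 0] fun ε : ℝ => ε ^ q := by
  refine (hfp.pow 2).congr' .rfl ?_
  filter_upwards [self_mem_nhdsWithin] with ε (hε : 0 < ε)
  rw [← Real.rpow_mul_natCast hε.le, Nat.cast_ofNat, hpq]

end PowerRates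

end SignalDetection

end

open SignalDetection in
theorem mainTheorem2_general {Ω : Type*} [MeasurableSpace Ω] (P : Measure Ω)
    [IsProbabilityMeasure P] (W : L2 → Ω → ℝ) (hW : IsWhiteNoise P W)
    (φ : ℕ+ → L2) (hφ : Orthonormal ℝ φ) (ϰ : ℝ → ℕ+ → ℝ) (hϰ : Conditions ϰ)
    (R τ : ℝ → ℝ) (hR : Tendsto R (𝓝[>] 0) atTop)
    (hRk : R =o[𝓝[>] 0] fun ε => √(cutoff ϰ ε : ℝ)) (hτ : ∀ᶠ ε in 𝓝[>] 0, 0 < τ ε)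
    (hτR : τ =Θ[𝓝[>] 0] fun ε => R ε * ε ^ 2 * √(cutoff ϰ ε : ℝ))
    (S : ℝ → L2) (hS : (fun ε => ‖S ε‖ ^ 2) =O[𝓝[>] 0] τ) :
    IsLDConsistent P W φ ϰ R S ↔
      ∃ c₁ > (0 : ℝ), ∃ c₂ > (0 : ℝ), ∃ ε₀ > (0 : ℝ), ∀ ε : ℝ, 0 < ε → ε < ε₀ →
        c₁ * τ ε <
          ∑' j : ℕ+, if (j : ℝ) < c₂ * cutoff ϰ ε then |fourierCoeff φ (S ε) j| ^ 2 else 0 := by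
  rw [isLDConsistent_iff_isBigO_energy hW hφ hϰ hR (hϰ.tendsto_mul_weight_one hRk),
    ← (hϰ.cutoffWeight_div_sq_mul_isTheta hτR).isBigO_congr_left,
    isBigO_energy_iff_exists_lt_lowFreqEnergy hφ hϰ hτ hS]
  simp only [(nhdsGT_basis (0 : ℝ)).eventually_iff, Set.mem_Ioo, and_imp, lowFreqEnergy]

open SignalDetection in
theorem mainTheorem2 {Ω : Type*} [MeasurableSpace Ω] (P : Measure Ω) [IsProbabilityMeasure P]
    (W : L2 → Ω → ℝ) (hW : IsWhiteNoise P W)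
    (φ : ℕ+ → L2) (hφ : Orthonormal ℝ φ)
    (ϰ : ℝ → ℕ+ → ℝ) (hϰ : Conditions ϰ)
    (r w : ℝ) (hr : 0 < r) (hr' : r < 1 / 2) (hw : 0 < 2 * w) (hw' : 2 * w < 1 - 2 * r)
    (hk : (fun ε => (cutoff ϰ ε : ℝ)) =Θ[𝓝[>] 0] fun ε : ℝ => ε ^ (-4 + 8 * r + 4 * w))
    (S : ℝ → L2) (hS : (fun ε => ‖S ε‖) =Θ[𝓝[>] 0] fun ε : ℝ => ε ^ (2 * r)) :
    IsLDConsistent P W φ ϰ (fun ε => ε ^ (-2 * w)) S ↔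
      ∃ c₁ > (0 : ℝ), ∃ c₂ > (0 : ℝ), ∃ ε₀ > (0 : ℝ), ∀ ε : ℝ, 0 < ε → ε < ε₀ →
        c₁ * ε ^ (4 * r) <
          ∑' j : ℕ+, if (j : ℝ) < c₂ * cutoff ϰ ε then |fourierCoeff φ (S ε) j| ^ 2 else 0 := by
  have hcutoff : ∀ ε, (0 : ℝ) ≤ cutoff ϰ ε := fun ε => Nat.cast_nonneg _
  exact mainTheorem2_general P W hW φ hφ ϰ hϰ _ _ (tendsto_rpow_neg_nhdsGT_zero (by linarith))
    (rpow_isLittleO_sqrt hcutoff hk (by linarith))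
    (eventually_nhdsWithin_of_forall fun ε hε => Real.rpow_pos_of_pos hε _)
    (rpow_isTheta_mul_sq_mul_sqrt hcutoff hk (by ring)) S (sq_isBigO_rpow hS.1 (by ring))
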